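/- All graphs are undirected, without loops and multiple edges, and possibly infinite unless said otherwise; $V(\Gamma)$ and $E(\Gamma)$ denote the sets of vertices and edges of a graph $\Gamma$. For graphs $K$ and $\Gamma$, the *edge representativeness* $\Upsilon_e(K,\Gamma)$ is the smallest cardinality of a set of edges $X\subseteq E(\Gamma)$ such that every (not necessarily induced) subgraph of $\Gamma$ isomorphic to $K$ contains an edge from $X$, and the *symmetric edge representativeness* $\Upsilon_e^{\mathrm{sym}}(K,\Gamma)$ is the smallest cardinality of such a set $X$ that is moreover invariant under all automorphisms of $\Gamma$; each of these values is $\infty$ if no finite set of the required kind exists. A finite graph $K$ is called *edge-costly* if for every $m\in\mathbb{Z}$ there is a graph $\Gamma_m$ for which $\Upsilon_e(K,\Gamma_m)$ and $\Upsilon_e^{\mathrm{sym}}(K,\Gamma_m)$ are finite and $$\Upsilon_e^{\mathrm{sym}}(K,\Gamma_m)=\Upsilon_e(K,\Gamma_m)\cdot|E(K)|\ge m .$$ **Theorem.** Let $K$ be a finite connected graph with exactly one vertex of degree one, and suppose that the graph obtained from $K$ by deleting this vertex and the edge incident to it is vertex-transitive (i.e. its automorphism group acts transitively on its vertices). Then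 $$\Upsilon_e^{\mathrm{sym}}(K,\Gamma)\le(|E(K)|-1)\cdot\Upsilon_e(K,\Gamma)$$ for every graph $\Gamma$. In particular, $K$ is not edge-costly. -/

import Mathlib

universe u v

namespace SimpleGraph

variable {V : Type u} {W : Type v}

/-- A graph is vertex-transitive if its automorphism group acts transitively on its vertices. -/
def IsVertexTransitive (G : SimpleGraph V) : Prop :=
  ∀ x y : V, ∃ φ : G ≃g G, φ x = y

/-- `X` is a set of edges of `Γ` such that every (not necessarily induced) subgraph of `Γ`
isomorphic to `K` contains an edge from `X`. -/
def IsEdgeRepresentative (K : SimpleGraph W) (Γ : SimpleGraph V) (X : Set (Sym2 V)) : Prop :=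
  X ⊆ Γ.edgeSet ∧
    ∀ H : Γ.Subgraph, Nonempty (K ≃g H.coe) → ∃ e ∈ H.edgeSet, e ∈ X

/-- A set `X` of unordered pairs of vertices of `Γ` is invariant under all automorphisms
of `Γ`. -/
def IsAutInvariant (Γ : SimpleGraph V) (X : Set (Sym2 V)) : Prop :=
  ∀ φ : Γ ≃g Γ, Sym2.map φ '' X = X

/-- The edge representativeness of `K` in `Γ`: the smallest cardinality of a set of edges of `Γ`
meeting every subgraph isomorphic to `K`, with value `⊤` if there is no such finite set. -/
noncomputable def edgeRep (K : SimpleGraph W) (Γ : SimpleGraph V) : ℕ∞ :=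
  sInf {n : ℕ∞ | ∃ X : Set (Sym2 V), IsEdgeRepresentative K Γ X ∧ X.encard = n}

/-- The symmetric edge representativeness of `K` in `Γ`: the smallest cardinality of an
`Aut Γ`-invariant set of edges of `Γ` meeting every subgraph isomorphic to `K`, with value `⊤` if
there is no such finite set. -/
noncomputable def symEdgeRep (K : SimpleGraph W) (Γ : SimpleGraph V) : ℕ∞ :=
  sInf {n : ℕ∞ | ∃ X : Set (Sym2 V),
    IsEdgeRepresentative K Γ X ∧ IsAutInvariant Γ X ∧ X.encard = n}

/-- A graph `K` is edge-costly if for every integer `m` there is a graph `Γ` such that the two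
representativenesses of `K` in `Γ` are integers (i.e. finite), the symmetric one is the other one
times the number of edges of `K`, and this number is at least `m`. The graphs `Γ` range over all,
possibly infinite, graphs with vertices in the universe `u`. -/
def IsEdgeCostly (K : SimpleGraph W) : Prop :=
  ∀ m : ℤ, ∃ (V : Type u) (Γ : SimpleGraph V) (n s : ℕ),
    edgeRep K Γ = n ∧ symEdgeRep K Γ = s ∧ s = n * K.edgeSet.ncard ∧ m ≤ (s : ℤ)

end SimpleGraph

/-! Let `M` be `K` without its pendant vertex, `e` its number of edges, and `X` a finite
edge-representative set. By vertex-transitivity a copy of `M` extends to a copy of `K` along any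
edge leaving it, so a copy of `M` that avoids `X` has its whole boundary in `X`. If that boundary is
nonempty, the vertex set is called an island. Every cut of `M` has at least two edges, so islands
are pairwise equal or disjoint.

Give an edge the density δ of `X` in its automorphism orbit, and a vertex set `S` the density `q(S)`
of islands in its orbit. The δ's sum to at most `|X|`. Linear inequalities valid for every translate
of `X` pass to densities (`le_of_mem_meanPairs`); Neumann's lemma takes care of infinite orbits. If
every copy of `M` had total density at least 1, the edges with δ ≥ 1/e would do: each copy contains
one, and there are at most `e|X|` of them.

The obstruction is a bad set `S`, spanned by a copy of density below 1. Let `m(S)` be the least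
density of a copy on `S`. Averaging gives `1 - m(S) ≤ q(S)`, and even `1 - m(S) ≤ q(S) - q(T)` when
`T` crosses `S`; hence bad sets are equal or disjoint. Start with weight `eδ` on each edge and
correct it invariantly at each bad set without raising the total. If it can be afforded (`IsCheap`),
the weight inside `S` is moved to the boundary, making every boundary edge weigh at least 1.
Otherwise weight is drawn from the boundary until every copy on `S` weighs at least `e`; the rate
drawn is at most 1/4 (`reduction_le`), small enough for crossing copies to keep weight `e`
(`one_le_weighted_hits`). The edges of weight at least 1 then form an invariant set of size at most
`e|X|` that meets every copy of `K`. -/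

namespace MulAction

/-! ### Densities in orbits and averaging over a group. -/

variable {G Z : Type*} [Group G] [MulAction G Z]

variable (G) in
/-- The proportion of the orbit of `z` that lies in `X`; it is `0` if the orbit is infinite. -/
noncomputable def density (X : Set Z) (z : Z) : ℝ :=
  ((orbit G z ∩ X).ncard : ℝ) / ((orbit G z).ncard : ℝ)

theorem density_smul (X : Set Z) (g : G) (z : Z) : density G X (g • z) = density G X z := by
  simp [density, orbit_smul]

theorem density_nonneg (X : Set Z) (z : Z) : 0 ≤ density G X z := by
  unfold density; positivity

theorem density_of_infinite {X : Set Z} {z : Z} (h : (orbit G z).Infinite) :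
    density G X z = 0 := by
  simp [density, h.ncard]

theorem exists_mem_orbit_of_density_ne_zero {X : Set Z} {z : Z} (h : density G X z ≠ 0) :
    (orbit G z).Finite ∧ ∃ x ∈ X, z ∈ orbit G x := by
  by_cases hf : (orbit G z).Finite
  · refine ⟨hf, ?_⟩
    have h1 : (orbit G z ∩ X).ncard ≠ 0 := by
      intro h0
      exact h (by simp [density, h0])
    obtain ⟨x, hx, hxX⟩ := Set.nonempty_of_ncard_ne_zero h1
    exact ⟨x, hxX, mem_orbit_symm.mp hx⟩
  · exact absurd (density_of_infinite hf) h

theorem finite_setOf_density_ne_zero {X : Set Z} (hX : X.Finite) :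
    {z : Z | density G X z ≠ 0}.Finite := by
  have : {z : Z | density G X z ≠ 0} ⊆
      ⋃ x ∈ {x ∈ X | (orbit G x).Finite}, orbit G x := by
    intro z hz
    obtain ⟨hf, x, hx, hzx⟩ := exists_mem_orbit_of_density_ne_zero hz
    refine Set.mem_biUnion (x := x) ⟨hx, ?_⟩ hzx
    rwa [← orbit_eq_iff.mpr hzx]
  exact ((hX.subset (Set.sep_subset _ _)).biUnion fun x hx => hx.2).subset this

/-- Double counting: each `x ∈ X` spreads one unit evenly over its orbit, or nothing if the orbit is
infinite. -/
theorem sum_density_le {X : Set Z} (hX : X.Finite) (P : Finset Z) :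
    ∑ z ∈ P, density G X z ≤ X.ncard := by
  classical
  have key : ∀ z ∈ P, density G X z =
      ∑ x ∈ hX.toFinset, if z ∈ orbit G x then 1 / ((orbit G x).ncard : ℝ) else 0 := by
    intro z _
    rw [← Finset.sum_filter]
    have : ∀ x ∈ hX.toFinset.filter (fun x => z ∈ orbit G x),
        1 / ((orbit G x).ncard : ℝ) = 1 / ((orbit G z).ncard : ℝ) := by
      intro x hx
      rw [orbit_eq_iff.mpr (Finset.mem_filter.mp hx).2]
    rw [Finset.sum_congr rfl this, Finset.sum_const, density, nsmul_eq_mul, mul_one_div]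
    congr 2
    rw [← Set.ncard_coe_finset]
    congr 1
    ext x
    simp [and_comm, mem_orbit_symm]
  rw [Finset.sum_congr rfl key, Finset.sum_comm, Set.ncard_eq_toFinset_card X hX,
    Finset.card_eq_sum_ones, Nat.cast_sum]
  refine Finset.sum_le_sum fun x _ => ?_
  rw [← Finset.sum_filter, Finset.sum_const, nsmul_eq_mul, mul_one_div, Nat.cast_one]
  by_cases hf : (orbit G x).Finite
  · refine div_le_one_of_le₀ ?_ (by positivity)
    rw [← Set.ncard_coe_finset]
    have hsub : ((P.filter fun z => z ∈ orbit G x : Finset Z) : Set Z) ⊆ orbit G x :=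
      fun z hz => (Finset.mem_filter.mp hz).2
    exact_mod_cast Set.ncard_le_ncard hsub hf
  · simp [Set.Infinite.ncard hf]

theorem finite_orbit_of_finiteIndex {H : Subgroup G} [H.FiniteIndex] {a : Z}
    (h : (stabilizer H a).FiniteIndex) : (orbit G a).Finite := by
  have h1 : (stabilizer H a) = (stabilizer G a).subgroupOf H := by
    ext x
    simp [Subgroup.mem_subgroupOf, mem_stabilizer_iff, Subgroup.smul_def]
  have h2 : ((stabilizer G a).relIndex H) ≠ 0 := by
    have := h.index_ne_zero
    rwa [h1] at this
  have h3 : (stabilizer G a ⊓ H).index ≠ 0 := by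
    rw [← Subgroup.relIndex_mul_index (inf_le_right : stabilizer G a ⊓ H ≤ H),
      Subgroup.inf_relIndex_right]
    exact mul_ne_zero h2 Subgroup.FiniteIndex.index_ne_zero
  have h4 : (stabilizer G a).index ≠ 0 := fun h0 =>
    h3 (by
      have := Subgroup.index_dvd_of_le (inf_le_left : stabilizer G a ⊓ H ≤ stabilizer G a)
      rw [h0] at this
      exact Nat.eq_zero_of_zero_dvd this)
  rw [index_stabilizer] at h4
  exact Set.finite_of_ncard_ne_zero h4

open scoped Pointwise in
/-- B. H. Neumann's separation lemma inside a coset of a subgroup of finite index. -/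
theorem exists_mem_forall_smul_notMem (H : Subgroup G) [H.FiniteIndex] {X : Set Z}
    (hX : X.Finite) (A : Finset Z) (hA : ∀ a ∈ A, (orbit G a).Infinite) (t : G) :
    ∃ h ∈ H, ∀ a ∈ A, (t * h) • a ∉ X := by
  classical
  by_contra! hcon
  let P : Z × Z → H → Prop := fun i h => (t * h) • i.1 = i.2
  -- The default `1` is harmless: surplus cosets do not spoil a cover, and any stabilizer of finite
  -- index yields the contradiction.
  let g : Z × Z → H := fun i => if hi : ∃ h, P i h then hi.choose else 1
  have hcov : ⋃ i ∈ A ×ˢ hX.toFinset, g i • ((stabilizer H i.1 : Subgroup H) : Set H)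
      = Set.univ := by
    refine Set.eq_univ_of_forall fun h => ?_
    obtain ⟨a, ha, hx⟩ := hcon h h.2
    refine Set.mem_biUnion (x := (a, (t * h) • a)) (by simp [ha, hx]) ?_
    have hi : ∃ h', P (a, (t * h) • a) h' := ⟨h, rfl⟩
    have hg : P (a, (t * h) • a) (g (a, (t * h) • a)) := by
      simp only [g, dif_pos hi]
      exact hi.choose_spec
    rw [mem_leftCoset_iff]
    simp only [SetLike.mem_coe, mem_stabilizer_iff]
    rw [mul_smul, inv_smul_eq_iff, Subgroup.smul_def, Subgroup.smul_def]
    simp only [P, mul_smul] at hg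
    simpa only [mul_smul] using (smul_left_cancel t hg).symm
  obtain ⟨i, hi, hfi⟩ := Subgroup.exists_finiteIndex_of_leftCoset_cover hcov
  exact hA i.1 (Finset.mem_product.mp hi).1 (finite_orbit_of_finiteIndex hfi)

theorem out_smul_of_le_stabilizer {H : Subgroup G} {a : Z} (hH : H ≤ stabilizer G a) (g : G) :
    ((g : G ⧸ H).out) • a = g • a := by
  obtain ⟨h, hh⟩ := QuotientGroup.mk_out_eq_mul H g
  rw [hh, mul_smul, show (h : G) • a = a from hH h.2]

theorem card_filter_out_smul_mem {H : Subgroup G} [Fintype (G ⧸ H)] {a : Z}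
    (hH : H ≤ stabilizer G a) (X : Set Z) [DecidablePred (· ∈ X)] (hO : (orbit G a).Finite) :
    ((Finset.univ.filter fun t : G ⧸ H => t.out • a ∈ X).card : ℝ) =
      Fintype.card (G ⧸ H) * density G X a := by
  classical
  set c := (Finset.univ.filter fun t : G ⧸ H => t.out • a = a).card with hc
  have hfib : ∀ x ∈ orbit G a, (Finset.univ.filter fun t : G ⧸ H => t.out • a = x).card = c := by
    rintro x ⟨g, rfl⟩
    have hout : ∀ t : G ⧸ H, (g • t).out • a = g • t.out • a := by
      intro t
      conv_lhs => rw [← QuotientGroup.out_eq' t]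
      rw [← QuotientGroup.mk_mul_of_mem _ (H.one_mem), MulAction.Quotient.smul_coe,
        out_smul_of_le_stabilizer hH]
      simp [mul_smul]
    refine (Finset.card_equiv (MulAction.toPerm g) fun t => ?_).symm
    simp [hout]
  have hcount : ∀ Y : Set Z, ((Finset.univ.filter fun t : G ⧸ H => t.out • a ∈ Y).card) =
      (orbit G a ∩ Y).ncard * c := by
    intro Y
    have hf := hO.subset (Set.inter_subset_left (t := Y))
    rw [Set.ncard_eq_toFinset_card _ hf, Finset.card_eq_sum_card_fiberwise
      (f := fun t : G ⧸ H => t.out • a) (t := hf.toFinset), Finset.sum_const_nat]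
    · intro x hx
      rw [Set.Finite.mem_toFinset] at hx
      rw [← hfib x hx.1, Finset.filter_filter]
      congr 1
      ext t
      simp only [Finset.mem_filter, Finset.mem_univ, true_and]
      exact ⟨fun h => h.2, fun h => ⟨h ▸ hx.2, h⟩⟩
    · intro t ht
      simp only [Finset.coe_filter, Finset.mem_univ, true_and, Set.mem_ofPred_eq] at ht
      simp [ht]
  have h1 := hcount X
  have h2 := hcount Set.univ
  simp only [Set.mem_univ, Finset.filter_true, Finset.card_univ, Set.inter_univ] at h2
  have hne : ((orbit G a).ncard : ℝ) ≠ 0 := by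
    have := (Set.ncard_pos hO).mpr ⟨a, mem_orbit_self a⟩
    exact_mod_cast this.ne'
  have h3 : (Finset.univ.filter fun t : G ⧸ H => t.out • a ∈ X).card =
      (orbit G a ∩ X).ncard * c := by convert h1
  rw [h3, h2, density]
  push_cast
  field_simp

/-- Let `H` fix all points of `A` with finite orbit; it has finite index. By Neumann's lemma each
coset of `H` has a representative moving the points with infinite orbit off `X`. Averaging the
hypothesis over these representatives gives density on finite orbits and 0 on infinite ones. -/
theorem le_sum_density {X : Set Z} (hX : X.Finite) (A : Finset Z) (k : Z → ℝ) (C : ℝ)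
    (h : ∀ g : G, C ≤ ∑ a ∈ A, k a * X.indicator 1 (g • a)) :
    C ≤ ∑ a ∈ A, k a * density G X a := by
  classical
  set Af := A.filter fun a => (orbit G a).Finite with hAf
  set Ai := A.filter fun a => ¬ (orbit G a).Finite with hAi
  set H : Subgroup G := ⨅ a : Af, stabilizer G (a : Z) with hHdef
  have hst : ∀ a ∈ Af, (stabilizer G a).FiniteIndex := by
    intro a ha
    refine ⟨?_⟩
    rw [index_stabilizer]
    exact ((Set.ncard_pos (Finset.mem_filter.mp ha).2).mpr ⟨a, mem_orbit_self a⟩).ne'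
  have hHf : H.FiniteIndex := Subgroup.finiteIndex_iInf fun a => hst a a.2
  have hle : ∀ a ∈ Af, H ≤ stabilizer G a := fun a ha => iInf_le (fun a : Af => _) ⟨a, ha⟩
  have := Fintype.ofFinite (G ⧸ H)
  have hsep : ∀ t : G ⧸ H, ∃ g : G, (∀ a ∈ Ai, g • a ∉ X) ∧ ∀ a ∈ Af, g • a = t.out • a := by
    intro t
    obtain ⟨y, hy, hy2⟩ := exists_mem_forall_smul_notMem H hX Ai
      (fun a ha => (Finset.mem_filter.mp ha).2) t.out
    refine ⟨t.out * y, hy2, fun a ha => ?_⟩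
    rw [mul_smul, show y • a = a from hle a ha hy]
  choose g hg1 hg2 using hsep
  have hcard : (0 : ℝ) < Fintype.card (G ⧸ H) := by exact_mod_cast Fintype.card_pos
  have h1 : ∑ t : G ⧸ H, C ≤ ∑ t : G ⧸ H, ∑ a ∈ A, k a * X.indicator 1 (g t • a) :=
    Finset.sum_le_sum fun t _ => h (g t)
  rw [Finset.sum_comm, Finset.sum_const, Finset.card_univ, nsmul_eq_mul] at h1
  have h2 : ∀ a ∈ A, ∑ t : G ⧸ H, k a * X.indicator (1 : Z → ℝ) (g t • a) =
      Fintype.card (G ⧸ H) * (k a * density G X a) := by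
    intro a ha
    rw [← Finset.mul_sum]
    by_cases hfa : (orbit G a).Finite
    · have haf : a ∈ Af := Finset.mem_filter.mpr ⟨ha, hfa⟩
      have : ∑ t : G ⧸ H, X.indicator (1 : Z → ℝ) (g t • a) =
          ((Finset.univ.filter fun t : G ⧸ H => t.out • a ∈ X).card : ℝ) := by
        rw [Finset.card_filter, Nat.cast_sum]
        refine Finset.sum_congr rfl fun t _ => ?_
        rw [hg2 t a haf]
        simp [Set.indicator_apply]
      rw [this, card_filter_out_smul_mem (hle a haf) X hfa]
      ring
    · rw [density_of_infinite hfa, Finset.sum_eq_zero]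
      · simp
      intro t _
      exact Set.indicator_of_notMem (hg1 t a (Finset.mem_filter.mpr ⟨ha, hfa⟩)) _
  rw [Finset.sum_congr rfl h2, ← Finset.mul_sum] at h1
  exact le_of_mul_le_mul_left h1 hcard

variable (G) in
/-- Pairs consisting of a linear combination of the functions `g ↦ 1_X (g • z)` on `G` and the same
linear combination of densities. -/
def meanPairs (X : Set Z) : Submodule ℝ ((G → ℝ) × ℝ) :=
  Submodule.span ℝ (Set.range fun z : Z =>
    ((fun g : G => X.indicator (1 : Z → ℝ) (g • z)), density G X z))

theorem mem_meanPairs (X : Set Z) (z : Z) :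
    ((fun g : G => X.indicator (1 : Z → ℝ) (g • z)), density G X z) ∈ meanPairs G X :=
  Submodule.subset_span ⟨z, rfl⟩

theorem le_of_mem_meanPairs {X : Set Z} (hX : X.Finite) {p : (G → ℝ) × ℝ}
    (hp : p ∈ meanPairs G X) {C : ℝ} (h : ∀ g, C ≤ p.1 g) : C ≤ p.2 := by
  obtain ⟨k, rfl⟩ := (Finsupp.mem_span_range_iff_exists_finsupp).mp hp
  simp only [Finsupp.sum, Prod.fst_sum, Prod.snd_sum, Prod.smul_fst, Prod.smul_snd,
    Finset.sum_apply, Pi.smul_apply, smul_eq_mul] at h ⊢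
  exact le_sum_density hX _ _ _ h

end MulAction

namespace SimpleGraph

/-! ### Cuts of vertex-transitive graphs. -/

section Cut

variable {U : Type*} {M : SimpleGraph U}

/-- Exactly one edge of `M` leaves the nonempty set `A`. -/
def IsSingleEdgeCut (M : SimpleGraph U) (A : Set U) : Prop :=
  ∃ u v, M.Adj u v ∧ u ∈ A ∧ v ∉ A ∧ ∀ p q, M.Adj p q → p ∈ A → q ∉ A → p = u ∧ q = v

/-- Uncrossing: translate the cut edge at `u` to another neighbour `x ∈ A` of `u`. As `x ≠ u`, the
translated edge stays inside `A`. One side of the translated cut misses `u`, and its intersection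
with `A` is a smaller set left by a single edge. -/
theorem not_isSingleEdgeCut [Finite U] (htr : M.IsVertexTransitive)
    (hdeg : ∀ u v, M.Adj u v → ∃ w, M.Adj u w ∧ w ≠ v) (A : Set U) :
    ¬ M.IsSingleEdgeCut A := by
  induction hn : A.ncard using Nat.strong_induction_on generalizing A with
  | _ n ih =>
  subst hn
  rintro ⟨u, v, huv, hu, hv, huniq⟩
  obtain ⟨x, hux, hxv⟩ := hdeg u v huv
  have hxA : x ∈ A := by
    by_contra h
    exact hxv (huniq u x hux hu h).2
  have hxu : x ≠ u := hux.ne'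
  obtain ⟨ψ, hψ⟩ := htr u x
  have hadj : M.Adj x (ψ v) := by
    rw [← hψ]
    exact ψ.map_adj_iff.mpr huv
  have hwA : ψ v ∈ A := by
    by_contra h
    exact hxu (huniq _ _ hadj hxA h).1
  have hB : ∀ p q, M.Adj p q → ψ.symm p ∈ A → ψ.symm q ∉ A → p = x ∧ q = ψ v := by
    intro p q hpq hp hq
    obtain ⟨h1, h2⟩ := huniq _ _ (ψ.symm.map_adj_iff.mpr hpq) hp hq
    constructor
    · rw [← hψ, ← h1]; simp
    · rw [← h2]; simp
  have hxB : ψ.symm x ∈ A := by rw [← hψ]; simpa using hu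
  have hwB : ψ.symm (ψ v) ∉ A := by simpa using hv
  -- One of the two sides of the translated cut avoids `u`.
  have main : ∀ (C : Set U) (y z : U), M.Adj y z → y ∈ A → z ∈ A → y ∈ C → z ∉ C → u ∉ C →
      (∀ p q, M.Adj p q → p ∈ C → q ∉ C → p = y ∧ q = z) → False := by
    intro C y z hyz hyA hzA hyC hzC huC hC
    refine ih (A ∩ C).ncard ?_ (A ∩ C) rfl ⟨y, z, hyz, ⟨hyA, hyC⟩, fun h => hzC h.2, ?_⟩
    · exact Set.ncard_lt_ncard ⟨Set.inter_subset_left, fun h => huC (h hu).2⟩ (Set.toFinite _)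
    · intro p q hpq hp hq
      by_cases hqA : q ∈ A
      · exact hC p q hpq hp.2 fun h => hq ⟨hqA, h⟩
      · exact absurd ((huniq p q hpq hp.1 hqA).1 ▸ hp.2) huC
  by_cases huB : ψ.symm u ∈ A
  · exact main {p | ψ.symm p ∉ A} (ψ v) x hadj.symm hwA hxA hwB (fun h => h hxB) (fun h => h huB)
      fun p q hpq hp hq => (hB q p hpq.symm (not_not.mp hq) hp).symm
  · exact main {p | ψ.symm p ∈ A} x (ψ v) hadj hxA hwA hxB hwB huB hB

/-- Every cut of a finite connected vertex-transitive graph of degree at least two has at least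
two edges. -/
theorem exists_two_crossing_edges [Finite U] (hc : M.Connected) (htr : M.IsVertexTransitive)
    (hdeg : ∀ u v, M.Adj u v → ∃ w, M.Adj u w ∧ w ≠ v) {A : Set U} (hA : A.Nonempty)
    (hA' : Aᶜ.Nonempty) :
    ∃ u v u' v', M.Adj u v ∧ u ∈ A ∧ v ∉ A ∧ M.Adj u' v' ∧ u' ∈ A ∧ v' ∉ A ∧
      s(u, v) ≠ s(u', v') := by
  obtain ⟨x, hx⟩ := hA
  obtain ⟨y, hy⟩ := hA'
  obtain ⟨⟨p⟩⟩ : Nonempty (M.Reachable x y) := ⟨hc.preconnected x y⟩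
  obtain ⟨d, -, hd1, hd2⟩ := p.exists_boundary_dart A hx hy
  by_contra! hcon
  refine not_isSingleEdgeCut htr hdeg A ⟨d.fst, d.snd, d.adj, hd1, hd2, fun q r hqr hq hr => ?_⟩
  have := hcon _ _ _ _ d.adj hd1 hd2 hqr hq hr
  rcases Sym2.eq_iff.mp this with h | h
  · exact ⟨h.1.symm, h.2.symm⟩
  · exact absurd (h.1 ▸ hd1) hr

end Cut

/-! ### Inside and boundary edges of vertex sets. -/

section Boundary

variable {V : Type*} (Γ : SimpleGraph V)

/-- The edges with both ends in `S`. -/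
def insideEdges (S : Set V) : Set (Sym2 V) :=
  {a | a ∈ Γ.edgeSet ∧ ∀ v ∈ a, v ∈ S}

/-- The edges with exactly one end in `S`. -/
def boundaryEdges (S : Set V) : Set (Sym2 V) :=
  {a | ∃ u v, Γ.Adj u v ∧ u ∈ S ∧ v ∉ S ∧ a = s(u, v)}

variable {Γ}

theorem boundaryEdges_subset (S : Set V) : Γ.boundaryEdges S ⊆ Γ.edgeSet := by
  rintro _ ⟨u, v, h, -, -, rfl⟩
  exact h

theorem map_mem_edgeSet_iff (g : Γ ≃g Γ) (a : Sym2 V) :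
    Sym2.map g a ∈ Γ.edgeSet ↔ a ∈ Γ.edgeSet := by
  induction a with
  | _ p q => exact g.map_adj_iff

theorem map_mem_insideEdges_iff (g : Γ ≃g Γ) (S : Set V) (a : Sym2 V) :
    Sym2.map g a ∈ Γ.insideEdges (g '' S) ↔ a ∈ Γ.insideEdges S := by
  refine and_congr (map_mem_edgeSet_iff g a) ?_
  induction a with
  | _ p q => simp

theorem map_mem_boundaryEdges_iff (g : Γ ≃g Γ) (S : Set V) (a : Sym2 V) :
    Sym2.map g a ∈ Γ.boundaryEdges (g '' S) ↔ a ∈ Γ.boundaryEdges S := by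
  constructor
  · rintro ⟨u, v, huv, ⟨u, hu, rfl⟩, hv, h⟩
    obtain ⟨v, rfl⟩ := g.surjective v
    refine ⟨u, v, g.map_adj_iff.mp huv, hu, fun h => hv ⟨v, h, rfl⟩, ?_⟩
    exact Sym2.map.injective g.injective (by simpa using h)
  · rintro ⟨u, v, huv, hu, hv, rfl⟩
    refine ⟨g u, g v, g.map_adj_iff.mpr huv, ⟨u, hu, rfl⟩, ?_, rfl⟩
    rintro ⟨v', hv', h⟩
    exact hv (g.injective h ▸ hv')

theorem boundaryEdges_image_nonempty (g : Γ ≃g Γ) (S : Set V) :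
    (Γ.boundaryEdges (g '' S)).Nonempty ↔ (Γ.boundaryEdges S).Nonempty := by
  constructor
  · rintro ⟨a, ha⟩
    refine ⟨Sym2.map g.symm a, (map_mem_boundaryEdges_iff g S _).mp ?_⟩
    rw [Sym2.map_map]
    simpa [Function.comp_def] using ha
  · rintro ⟨a, ha⟩
    exact ⟨_, (map_mem_boundaryEdges_iff g S a).mpr ha⟩

theorem disjoint_insideEdges_boundaryEdges {S T : Set V} (h : S = T ∨ Disjoint S T) {a : Sym2 V}
    (ha : a ∈ Γ.insideEdges S) : a ∉ Γ.boundaryEdges T := by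
  rintro ⟨u, v, -, hu, hv, rfl⟩
  have h1 : u ∈ S := ha.2 u (by simp)
  have h2 : v ∈ S := ha.2 v (by simp)
  rcases h with rfl | h
  · exact hv h2
  · exact Set.disjoint_left.mp h h1 hu

theorem notMem_insideEdges_of_disjoint {S T : Set V} (h : Disjoint S T) {a : Sym2 V}
    (ha : a ∈ Γ.insideEdges S) : a ∉ Γ.insideEdges T := by
  intro hb
  induction a with
  | _ p q => exact Set.disjoint_left.mp h (ha.2 p (by simp)) (hb.2 p (by simp))

/-- An edge lies on the boundary of at most two of any pairwise disjoint sets. -/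
theorem card_le_two_of_mem_boundaryEdges {F : Finset (Set V)}
    (hF : ∀ S ∈ F, ∀ T ∈ F, S ≠ T → Disjoint S T) {a : Sym2 V}
    (ha : ∀ S ∈ F, a ∈ Γ.boundaryEdges S) : F.card ≤ 2 := by
  classical
  induction a with
  | _ p q =>
    have hpq : ∀ S ∈ F, p ∈ S ∨ q ∈ S := by
      intro S hS
      obtain ⟨u, v, -, hu, -, h⟩ := ha S hS
      rcases Sym2.eq_iff.mp h with h | h
      · exact Or.inl (h.1 ▸ hu)
      · exact Or.inr (h.2 ▸ hu)
    calc F.card ≤ ({p, q} : Finset V).card := by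
          refine Finset.card_le_card_of_injOn (fun S => if p ∈ S then p else q) ?_ ?_
          · intro S _
            by_cases h : p ∈ S <;> simp [h]
          · intro S hS T hT h
            have hS' : (if p ∈ S then p else q) ∈ S := by
              split_ifs with h1
              · exact h1
              · exact (hpq S hS).resolve_left h1
            have hT' : (if p ∈ T then p else q) ∈ T := by
              split_ifs with h1
              · exact h1
              · exact (hpq T hT).resolve_left h1
            by_contra hne
            simp only at h
            exact Set.disjoint_left.mp (hF S hS T hT hne) hS' (h ▸ hT')
      _ ≤ 2 := Finset.card_le_two

end Boundary

/-! ### Islands, and inequalities for a single set `X`. -/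

section Islands

variable {V : Type u} {U : Type*} (M : SimpleGraph U) (Γ : SimpleGraph V) (X : Set (Sym2 V))

/-- Every copy of `M` in `Γ` avoiding `X` has all its boundary edges in `X`. -/
def IsBoundaryRepresentative : Prop :=
  ∀ φ : Copy M Γ, (∀ b ∈ M.edgeSet, Sym2.map φ b ∉ X) → Γ.boundaryEdges (Set.range φ) ⊆ X

/-- The vertex sets, with nonempty boundary, of copies of `M` avoiding `X`. -/
def islands : Set (Set V) :=
  {S | (Γ.boundaryEdges S).Nonempty ∧
    ∃ φ : Copy M Γ, Set.range φ = S ∧ ∀ b ∈ M.edgeSet, Sym2.map φ b ∉ X}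

variable {M Γ X}

theorem range_comp_copy (g : Γ ≃g Γ) (φ : Copy M Γ) :
    Set.range (g.toCopy.comp φ) = g '' Set.range φ := by
  rw [Copy.coe_comp, Set.range_comp]
  rfl

theorem map_comp_copy (g : Γ ≃g Γ) (φ : Copy M Γ) (b : Sym2 U) :
    Sym2.map (g.toCopy.comp φ) b = Sym2.map g (Sym2.map φ b) := by
  rw [Sym2.map_map]
  rfl

theorem map_mem_insideEdges (φ : Copy M Γ) {b : Sym2 U} (hb : b ∈ M.edgeSet) :
    Sym2.map φ b ∈ Γ.insideEdges (Set.range φ) := by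
  induction b with
  | _ x y => exact ⟨φ.toHom.map_adj hb, by simp⟩

theorem IsBoundaryRepresentative.preimage (hX : IsBoundaryRepresentative M Γ X) (g : Γ ≃g Γ) :
    IsBoundaryRepresentative M Γ (Sym2.map g ⁻¹' X) := by
  intro φ hφ a ha
  refine hX (g.toCopy.comp φ) (fun b hb => ?_) ?_
  · rw [map_comp_copy]
    exact hφ b hb
  · rw [range_comp_copy]
    exact (map_mem_boundaryEdges_iff g _ a).mpr ha

theorem image_mem_islands_iff (g : Γ ≃g Γ) (S : Set V) :
    g '' S ∈ islands M Γ X ↔ S ∈ islands M Γ (Sym2.map g ⁻¹' X) := by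
  unfold islands
  simp only [Set.mem_ofPred_eq, boundaryEdges_image_nonempty]
  refine and_congr_right fun _ => ⟨?_, ?_⟩
  · rintro ⟨φ, hφ, h⟩
    refine ⟨g.symm.toCopy.comp φ, ?_, fun b hb => ?_⟩
    · rw [range_comp_copy, hφ]
      exact g.toEquiv.symm_image_image S
    · rw [map_comp_copy, Set.mem_preimage, Sym2.map_map]
      simpa [Function.comp_def] using h b hb
  · rintro ⟨φ, hφ, h⟩
    refine ⟨g.toCopy.comp φ, by rw [range_comp_copy, hφ], fun b hb => ?_⟩
    rw [map_comp_copy]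
    exact h b hb

theorem boundaryEdges_subset_of_mem_islands (hX : IsBoundaryRepresentative M Γ X) {S : Set V}
    (hS : S ∈ islands M Γ X) : Γ.boundaryEdges S ⊆ X := by
  obtain ⟨-, φ, rfl, h⟩ := hS
  exact hX φ h

variable (M) in
/-- Every cut of `M` contains at least two edges. -/
def HasTwoCrossing : Prop :=
  ∀ A : Set U, A.Nonempty → Aᶜ.Nonempty → ∃ u v u' v', M.Adj u v ∧ u ∈ A ∧ v ∉ A ∧
    M.Adj u' v' ∧ u' ∈ A ∧ v' ∉ A ∧ s(u, v) ≠ s(u', v')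

/-- The set `T` contains some but not all vertices of the copy `φ`. -/
def Crosses (T : Set V) (φ : Copy M Γ) : Prop :=
  (Set.range φ ∩ T).Nonempty ∧ (Set.range φ \ T).Nonempty

theorem Crosses.exists_two_edges (h2 : HasTwoCrossing M) {T : Set V} {φ : Copy M Γ}
    (h : Crosses T φ) : ∃ b ∈ M.edgeSet, ∃ b' ∈ M.edgeSet, b ≠ b' ∧
      Sym2.map φ b ∈ Γ.boundaryEdges T ∧ Sym2.map φ b' ∈ Γ.boundaryEdges T := by
  obtain ⟨⟨_, ⟨x, rfl⟩, hx⟩, ⟨_, ⟨y, rfl⟩, hy⟩⟩ := h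
  obtain ⟨u, v, u', v', h1, hu, hv, h1', hu', hv', hne⟩ := h2 (φ ⁻¹' T) ⟨x, hx⟩ ⟨y, hy⟩
  exact ⟨_, h1, _, h1', hne, ⟨_, _, φ.toHom.map_adj h1, hu, hv, rfl⟩,
    ⟨_, _, φ.toHom.map_adj h1', hu', hv', rfl⟩⟩

theorem ncard_range_copy (φ : Copy M Γ) : (Set.range φ).ncard = Nat.card U := by
  rw [← Set.image_univ, ← Set.ncard_univ]
  exact Set.ncard_image_of_injective _ φ.injective

theorem eq_or_disjoint_or_crosses [Finite U] (φ ψ : Copy M Γ) :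
    Set.range φ = Set.range ψ ∨ Disjoint (Set.range φ) (Set.range ψ) ∨
      (Crosses (Set.range ψ) φ ∧ Crosses (Set.range φ) ψ) := by
  by_cases hd : Disjoint (Set.range φ) (Set.range ψ)
  · exact Or.inr (Or.inl hd)
  by_cases he : Set.range φ = Set.range ψ
  · exact Or.inl he
  have hne := Set.not_disjoint_iff_nonempty_inter.mp hd
  refine Or.inr (Or.inr ⟨⟨hne, ?_⟩, ⟨Set.inter_comm _ _ ▸ hne, ?_⟩⟩)
  · rw [Set.sdiff_nonempty]
    intro hs
    exact he (Set.eq_of_subset_of_ncard_le hs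
      (by rw [ncard_range_copy, ncard_range_copy]) (Set.finite_range _))
  · rw [Set.sdiff_nonempty]
    intro hs
    exact he (Set.eq_of_subset_of_ncard_le hs
      (by rw [ncard_range_copy, ncard_range_copy]) (Set.finite_range _)).symm

/-- If `T` crossed the copy on `S`, an edge of that copy would lie on the boundary of `T`, hence in
`X`, which the copy avoids. -/
theorem eq_or_disjoint_of_mem_islands [Finite U] (h2 : HasTwoCrossing M)
    (hX : IsBoundaryRepresentative M Γ X) {S T : Set V} (hS : S ∈ islands M Γ X)
    (hT : T ∈ islands M Γ X) : S = T ∨ Disjoint S T := by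
  have hTX := boundaryEdges_subset_of_mem_islands hX hT
  obtain ⟨-, φ, rfl, hφ⟩ := hS
  obtain ⟨-, ψ, rfl, hψ⟩ := hT
  rcases eq_or_disjoint_or_crosses φ ψ with h | h | ⟨h, -⟩
  · exact Or.inl h
  · exact Or.inr h
  · obtain ⟨b, hb, -, -, -, hbT, -⟩ := h.exists_two_edges h2
    exact absurd (hTX hbT) (hφ b hb)

/-- An island contains an end of an edge of `X`, because its boundary is nonempty; by disjointness
each such vertex lies in at most one island. -/
theorem finite_islands [Finite U] (h2 : HasTwoCrossing M) (hX : IsBoundaryRepresentative M Γ X)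
    (hfin : X.Finite) : (islands M Γ X).Finite := by
  have hW : (⋃ a ∈ X, {v : V | v ∈ a}).Finite := by
    refine hfin.biUnion fun a _ => ?_
    induction a with
    | _ p q => exact (Set.toFinite {p, q}).subset fun v hv => by simpa using hv
  have hsub : islands M Γ X ⊆ ⋃ v ∈ ⋃ a ∈ X, {v : V | v ∈ a}, {S ∈ islands M Γ X | v ∈ S} := by
    intro S hS
    obtain ⟨a, ha⟩ := hS.1
    have haX := boundaryEdges_subset_of_mem_islands hX hS ha
    obtain ⟨u, v, -, hu, -, rfl⟩ := ha
    exact Set.mem_biUnion (Set.mem_biUnion haX (by simp : u ∈ s(u, v))) ⟨hS, hu⟩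
  refine (hW.biUnion fun v _ => Set.Subsingleton.finite ?_).subset hsub
  rintro S ⟨hS, hvS⟩ T ⟨hT, hvT⟩
  exact (eq_or_disjoint_of_mem_islands h2 hX hS hT).resolve_right
    fun h => Set.disjoint_left.mp h hvS hvT

variable [Fintype U] [DecidableRel M.Adj]

theorem one_le_hits_add_island (φ : Copy M Γ)
    (hbd : (Γ.boundaryEdges (Set.range φ)).Nonempty) :
    1 ≤ ∑ b ∈ M.edgeFinset, X.indicator (1 : Sym2 V → ℝ) (Sym2.map φ b) +
      (islands M Γ X).indicator 1 (Set.range φ) := by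
  have hnn : ∀ b ∈ M.edgeFinset, 0 ≤ X.indicator (1 : Sym2 V → ℝ) (Sym2.map φ b) :=
    fun b _ => Set.indicator_nonneg (fun _ _ => zero_le_one) _
  by_cases h : ∀ b ∈ M.edgeSet, Sym2.map φ b ∉ X
  · rw [Set.indicator_of_mem (show Set.range φ ∈ islands M Γ X from ⟨hbd, φ, rfl, h⟩)]
    have := Finset.sum_nonneg hnn
    simpa using this
  · push Not at h
    obtain ⟨b, hb, hbX⟩ := h
    have h1 := Finset.single_le_sum hnn (mem_edgeFinset.mpr hb)
    rw [Set.indicator_of_mem hbX] at h1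
    have h2 : 0 ≤ (islands M Γ X).indicator (1 : Set V → ℝ) (Set.range φ) :=
      Set.indicator_nonneg (fun _ _ => zero_le_one) _
    simp only [Pi.one_apply] at h1
    linarith

-- The pointwise form of the estimate for copies crossed by bad sets. The parameter `l` splits the
-- gain between the penalties over `F` and the single term for `T₀`. If no island crosses the copy,
-- all penalties vanish. Otherwise the edges of the copy on island boundaries all lie in `X`, there
-- are at least two of them, and each is penalised at most twice.
open Classical in
theorem one_le_weighted_hits (h2 : HasTwoCrossing M) (hX : IsBoundaryRepresentative M Γ X)
    (φ : Copy M Γ) (hbd : (Γ.boundaryEdges (Set.range φ)).Nonempty) {F : Finset (Set V)}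
    (hF : ∀ T ∈ F, Crosses T φ) {T₀ : Set V} (hT₀ : Crosses T₀ φ) {l : ℝ} (hl0 : 0 ≤ l)
    (hl1 : l ≤ 1) :
    1 ≤ ∑ b ∈ M.edgeFinset, X.indicator (1 : Sym2 V → ℝ) (Sym2.map φ b) -
      ∑ T ∈ F, l / 4 * (M.edgeFinset.filter fun b => Sym2.map φ b ∈ Γ.boundaryEdges T).card *
        (islands M Γ X).indicator 1 T +
      (islands M Γ X).indicator 1 (Set.range φ) -
      (1 - l) * (islands M Γ X).indicator 1 T₀ := by
  have hbase := one_le_hits_add_island (X := X) φ hbd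
  have hnn : ∀ b ∈ M.edgeFinset, 0 ≤ X.indicator (1 : Sym2 V → ℝ) (Sym2.map φ b) :=
    fun b _ => Set.indicator_nonneg (fun _ _ => zero_le_one) _
  by_cases hex : ∃ T ∈ islands M Γ X, Crosses T φ
  · obtain ⟨T, hT, hTφ⟩ := hex
    set B := M.edgeFinset.filter fun b => ∃ T ∈ islands M Γ X, Sym2.map φ b ∈ Γ.boundaryEdges T
      with hB
    have hm2 : 2 ≤ B.card := by
      obtain ⟨b, hb, b', hb', hne, h1, h1'⟩ := hTφ.exists_two_edges h2
      rw [← Finset.card_pair hne]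
      refine Finset.card_le_card ?_
      intro c hc
      rcases Finset.mem_insert.mp hc with rfl | hc
      · exact Finset.mem_filter.mpr ⟨mem_edgeFinset.mpr hb, T, hT, h1⟩
      · rw [Finset.mem_singleton.mp hc]
        exact Finset.mem_filter.mpr ⟨mem_edgeFinset.mpr hb', T, hT, h1'⟩
    have hxm : (B.card : ℝ) ≤
        ∑ b ∈ M.edgeFinset, X.indicator (1 : Sym2 V → ℝ) (Sym2.map φ b) := by
      calc (B.card : ℝ) = ∑ b ∈ B, X.indicator (1 : Sym2 V → ℝ) (Sym2.map φ b) := by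
            rw [Finset.card_eq_sum_ones, Nat.cast_sum]
            refine Finset.sum_congr rfl fun b hb => ?_
            obtain ⟨-, T', hT', hbT'⟩ := Finset.mem_filter.mp hb
            rw [Set.indicator_of_mem (boundaryEdges_subset_of_mem_islands hX hT' hbT')]
            simp
        _ ≤ _ := Finset.sum_le_sum_of_subset_of_nonneg (Finset.filter_subset _ _)
            fun b hb _ => hnn b hb
    have hk : ∑ T ∈ F, ((M.edgeFinset.filter fun b =>
        Sym2.map φ b ∈ Γ.boundaryEdges T).card : ℝ) * (islands M Γ X).indicator 1 T
        ≤ 2 * B.card := by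
      have h1 : ∀ T ∈ F, ((M.edgeFinset.filter fun b =>
          Sym2.map φ b ∈ Γ.boundaryEdges T).card : ℝ) * (islands M Γ X).indicator 1 T =
          ∑ b ∈ M.edgeFinset,
            if T ∈ islands M Γ X ∧ Sym2.map φ b ∈ Γ.boundaryEdges T then (1 : ℝ) else 0 := by
        intro T _
        by_cases hT : T ∈ islands M Γ X <;> simp [hT]
      rw [Finset.sum_congr rfl h1, Finset.sum_comm]
      have h3 : ∀ b ∈ M.edgeFinset, (∑ T ∈ F,
          if T ∈ islands M Γ X ∧ Sym2.map φ b ∈ Γ.boundaryEdges T then (1 : ℝ) else 0) ≤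
          if b ∈ B then 2 else 0 := by
        intro b hb
        rw [← Finset.sum_filter, Finset.sum_const, nsmul_eq_mul, mul_one]
        split_ifs with hbB
        · have := card_le_two_of_mem_boundaryEdges (Γ := Γ) (a := Sym2.map φ b)
            (F := F.filter fun T => T ∈ islands M Γ X ∧ Sym2.map φ b ∈ Γ.boundaryEdges T)
            (fun S hS T hT hne => (eq_or_disjoint_of_mem_islands h2 hX
              (Finset.mem_filter.mp hS).2.1 (Finset.mem_filter.mp hT).2.1).resolve_left hne)
            (fun S hS => (Finset.mem_filter.mp hS).2.2)
          exact_mod_cast this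
        · rw [Finset.filter_false_of_mem, Finset.card_empty, Nat.cast_zero]
          intro T _ hT
          exact hbB (Finset.mem_filter.mpr ⟨hb, T, hT⟩)
      refine (Finset.sum_le_sum h3).trans ?_
      rw [← Finset.sum_filter, Finset.sum_const, nsmul_eq_mul, mul_comm]
      gcongr
      intro b hb
      exact (Finset.mem_filter.mp hb).2
    have hyS : 0 ≤ (islands M Γ X).indicator (1 : Set V → ℝ) (Set.range φ) :=
      Set.indicator_nonneg (fun _ _ => zero_le_one) _
    have hy0 : (islands M Γ X).indicator (1 : Set V → ℝ) T₀ ≤ 1 :=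
      Set.indicator_le_self' (fun _ _ => zero_le_one) _
    simp only [mul_assoc, ← Finset.mul_sum]
    -- With `n = B.card ≥ 2`, the right-hand side is at least `n - (l / 2) * n - (1 - l) ≥ 1`; this
    -- is what the constant 1/4 is for.
    have h4 : (2 : ℝ) ≤ B.card := by exact_mod_cast hm2
    nlinarith [mul_le_mul_of_nonneg_left hk (by positivity : 0 ≤ l / 4),
      mul_le_mul_of_nonneg_left hy0 (by linarith : 0 ≤ 1 - l),
      mul_nonneg (by linarith : (0 : ℝ) ≤ B.card - 2) (by linarith : 0 ≤ 2 - l)]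
  · push Not at hex
    have hz : ∀ T, Crosses T φ → (islands M Γ X).indicator (1 : Set V → ℝ) T = 0 :=
      fun T hT => Set.indicator_of_notMem (fun h => hex T h hT) _
    have hFz : ∑ T ∈ F, l / 4 * (M.edgeFinset.filter fun b =>
        Sym2.map φ b ∈ Γ.boundaryEdges T).card * (islands M Γ X).indicator (1 : Set V → ℝ) T = 0 :=
      Finset.sum_eq_zero fun T hT => by rw [hz T (hF T hT), mul_zero]
    rw [hFz, hz T₀ hT₀]
    linarith

end Islands

/-! ### Densities of edges and islands under automorphisms. -/

section Density

variable {V : Type u} {U : Type*} (M : SimpleGraph U) (Γ : SimpleGraph V) (X : Set (Sym2 V))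

/-- A single action on edges and vertex sets together lets both kinds of indicator be averaged over
the same automorphisms. -/
instance autMulAction : MulAction (Γ ≃g Γ) (Sym2 V ⊕ Set V) where
  smul g := Sum.map (Sym2.map g) (Set.image g)
  one_smul z := by
    change Sum.map (Sym2.map (id : V → V)) (Set.image (id : V → V)) z = z
    rcases z with a | S <;> simp
  mul_smul g h z := by
    change Sum.map (Sym2.map (g ∘ h)) (Set.image (g ∘ h)) z =
      Sum.map (Sym2.map g) (Set.image g) (Sum.map (Sym2.map h) (Set.image h) z)
    rcases z with a | S
    · simp [Sym2.map_map]
    · simp [Set.image_image]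

variable {Γ} in
@[simp] theorem smul_inl (g : Γ ≃g Γ) (a : Sym2 V) :
    g • (Sum.inl a : Sym2 V ⊕ Set V) = Sum.inl (Sym2.map g a) := rfl

variable {Γ} in
@[simp] theorem smul_inr (g : Γ ≃g Γ) (S : Set V) :
    g • (Sum.inr S : Sym2 V ⊕ Set V) = Sum.inr (g '' S) := rfl

/-- The edges in `X` together with the islands of `X`. -/
def hitsAndIslands : Set (Sym2 V ⊕ Set V) := Sum.inl '' X ∪ Sum.inr '' islands M Γ X

/-- The density of `X` in the automorphism orbit of an edge. -/
noncomputable def hitDensity (a : Sym2 V) : ℝ :=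
  MulAction.density (Γ ≃g Γ) (hitsAndIslands M Γ X) (Sum.inl a)

/-- The density of islands in the automorphism orbit of a set of vertices. -/
noncomputable def islandDensity (S : Set V) : ℝ :=
  MulAction.density (Γ ≃g Γ) (hitsAndIslands M Γ X) (Sum.inr S)

variable {M Γ X}

theorem hitDensity_nonneg (a : Sym2 V) : 0 ≤ hitDensity M Γ X a := MulAction.density_nonneg _ _

theorem islandDensity_nonneg (S : Set V) : 0 ≤ islandDensity M Γ X S :=
  MulAction.density_nonneg _ _

theorem hitDensity_map (g : Γ ≃g Γ) (a : Sym2 V) :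
    hitDensity M Γ X (Sym2.map g a) = hitDensity M Γ X a :=
  MulAction.density_smul _ g (Sum.inl a)

theorem islandDensity_image (g : Γ ≃g Γ) (S : Set V) :
    islandDensity M Γ X (g '' S) = islandDensity M Γ X S :=
  MulAction.density_smul _ g (Sum.inr S)

theorem indicator_smul_inl (g : Γ ≃g Γ) (a : Sym2 V) :
    (hitsAndIslands M Γ X).indicator (1 : Sym2 V ⊕ Set V → ℝ) (g • Sum.inl a) =
      (Sym2.map g ⁻¹' X).indicator 1 a := by
  classical
  simp [Set.indicator_apply, hitsAndIslands]

theorem indicator_smul_inr (g : Γ ≃g Γ) (S : Set V) :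
    (hitsAndIslands M Γ X).indicator (1 : Sym2 V ⊕ Set V → ℝ) (g • Sum.inr S) =
      (islands M Γ (Sym2.map g ⁻¹' X)).indicator 1 S := by
  classical
  simp [Set.indicator_apply, hitsAndIslands, ← image_mem_islands_iff]

variable (M Γ X) in
/-- Linear combinations of indicators of translates of edges and of vertex sets, paired with their
mean values. -/
noncomputable abbrev meanPairs : Submodule ℝ ((Γ ≃g Γ → ℝ) × ℝ) :=
  MulAction.meanPairs (Γ ≃g Γ) (hitsAndIslands M Γ X)

theorem edge_mem_meanPairs (a : Sym2 V) :
    ((fun g => (Sym2.map g ⁻¹' X).indicator 1 a, hitDensity M Γ X a) : (Γ ≃g Γ → ℝ) × ℝ) ∈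
      meanPairs M Γ X := by
  have := MulAction.mem_meanPairs (G := Γ ≃g Γ) (hitsAndIslands M Γ X) (Sum.inl a)
  simp only [indicator_smul_inl] at this
  exact this

theorem island_mem_meanPairs (S : Set V) :
    ((fun g => (islands M Γ (Sym2.map g ⁻¹' X)).indicator 1 S, islandDensity M Γ X S) :
      (Γ ≃g Γ → ℝ) × ℝ) ∈ meanPairs M Γ X := by
  have := MulAction.mem_meanPairs (G := Γ ≃g Γ) (hitsAndIslands M Γ X) (Sum.inr S)
  simp only [indicator_smul_inr] at this
  exact this

theorem sum_hitDensity_le (hfin : X.Finite) (P : Finset (Sym2 V)) :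
    ∑ a ∈ P, hitDensity M Γ X a ≤ X.ncard := by
  classical
  have h1 : ∀ a, hitDensity M Γ X a =
      MulAction.density (Γ ≃g Γ) (Sum.inl '' X : Set (Sym2 V ⊕ Set V)) (Sum.inl a) := by
    intro a
    unfold hitDensity MulAction.density
    congr 3
    ext z
    refine and_congr_right fun hz => ⟨?_, fun h => Or.inl h⟩
    rintro (h | ⟨S, -, rfl⟩)
    · exact h
    · obtain ⟨g, hg⟩ := hz
      simp at hg
  have h2 := MulAction.sum_density_le (G := Γ ≃g Γ)
    (hfin.image (Sum.inl : Sym2 V → Sym2 V ⊕ Set V)) (P.map ⟨Sum.inl, Sum.inl_injective⟩)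
  rw [Finset.sum_map, Set.ncard_image_of_injective _ Sum.inl_injective] at h2
  simp only [h1]
  exact h2

variable [Fintype U]

theorem finite_hitsAndIslands (h2 : HasTwoCrossing M) (hX : IsBoundaryRepresentative M Γ X)
    (hfin : X.Finite) : (hitsAndIslands M Γ X).Finite :=
  (hfin.image _).union ((finite_islands h2 hX hfin).image _)

theorem finite_hitDensity_ne_zero (h2 : HasTwoCrossing M) (hX : IsBoundaryRepresentative M Γ X)
    (hfin : X.Finite) : {a | hitDensity M Γ X a ≠ 0}.Finite :=
  (MulAction.finite_setOf_density_ne_zero (finite_hitsAndIslands h2 hX hfin)).preimage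
    Sum.inl_injective.injOn

theorem finite_islandDensity_ne_zero (h2 : HasTwoCrossing M) (hX : IsBoundaryRepresentative M Γ X)
    (hfin : X.Finite) : {S | islandDensity M Γ X S ≠ 0}.Finite :=
  (MulAction.finite_setOf_density_ne_zero (finite_hitsAndIslands h2 hX hfin)).preimage
    Sum.inr_injective.injOn

/-- Whenever a translate of `S` is an island, the corresponding translate of its boundary edge `a`
is in `X`. -/
theorem islandDensity_le_hitDensity (h2 : HasTwoCrossing M)
    (hX : IsBoundaryRepresentative M Γ X) (hfin : X.Finite) {S : Set V} {a : Sym2 V}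
    (ha : a ∈ Γ.boundaryEdges S) : islandDensity M Γ X S ≤ hitDensity M Γ X a := by
  have hmem := (meanPairs M Γ X).sub_mem (edge_mem_meanPairs a) (island_mem_meanPairs S)
  refine sub_nonneg.mp (MulAction.le_of_mem_meanPairs (finite_hitsAndIslands h2 hX hfin) hmem
    (C := 0) fun g => ?_)
  simp only [Prod.mk_sub_mk, Pi.sub_apply, sub_nonneg]
  by_cases hS : S ∈ islands M Γ (Sym2.map g ⁻¹' X)
  · rw [Set.indicator_of_mem hS, Set.indicator_of_mem
      (boundaryEdges_subset_of_mem_islands (hX.preimage g) hS ha)]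
    simp
  · rw [Set.indicator_of_notMem hS]
    exact Set.indicator_nonneg (fun _ _ => zero_le_one) _

theorem islandDensity_le_one (h2 : HasTwoCrossing M)
    (hX : IsBoundaryRepresentative M Γ X) (hfin : X.Finite) (S : Set V) :
    islandDensity M Γ X S ≤ 1 := by
  have hmem := (meanPairs M Γ X).neg_mem (island_mem_meanPairs S)
  refine neg_le_neg_iff.mp (MulAction.le_of_mem_meanPairs (finite_hitsAndIslands h2 hX hfin) hmem
    (C := -1) fun g => ?_)
  simp only [Prod.neg_mk, Pi.neg_apply, neg_le_neg_iff]
  exact Set.indicator_le_self' (fun _ _ => zero_le_one) _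

variable [DecidableRel M.Adj]

variable (X) in
/-- The total density of the edges of a copy of `M`. -/
noncomputable def copyDensity (φ : Copy M Γ) : ℝ :=
  ∑ b ∈ M.edgeFinset, hitDensity M Γ X (Sym2.map φ b)

theorem copyDensity_comp (g : Γ ≃g Γ) (φ : Copy M Γ) :
    copyDensity X (g.toCopy.comp φ) = copyDensity X φ :=
  Finset.sum_congr rfl fun b _ => by rw [map_comp_copy, hitDensity_map]

theorem one_le_copyDensity_add (h2 : HasTwoCrossing M)
    (hX : IsBoundaryRepresentative M Γ X) (hfin : X.Finite) (φ : Copy M Γ)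
    (hbd : (Γ.boundaryEdges (Set.range φ)).Nonempty) :
    1 ≤ copyDensity X φ + islandDensity M Γ X (Set.range φ) := by
  classical
  have hmem := (meanPairs M Γ X).add_mem
    ((meanPairs M Γ X).sum_mem fun b (_ : b ∈ M.edgeFinset) =>
      edge_mem_meanPairs (Sym2.map φ b)) (island_mem_meanPairs (Set.range φ))
  have := MulAction.le_of_mem_meanPairs (finite_hitsAndIslands h2 hX hfin) hmem
    (C := 1) fun g => by
      simpa [Prod.fst_sum] using
        one_le_hits_add_island (X := Sym2.map g ⁻¹' X) φ hbd
  simpa [Prod.snd_sum, copyDensity] using this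

open Classical in
theorem one_le_weighted_copyDensity (h2 : HasTwoCrossing M)
    (hX : IsBoundaryRepresentative M Γ X) (hfin : X.Finite) (φ : Copy M Γ)
    (hbd : (Γ.boundaryEdges (Set.range φ)).Nonempty) {F : Finset (Set V)}
    (hF : ∀ T ∈ F, Crosses T φ) {T₀ : Set V} (hT₀ : Crosses T₀ φ) {l : ℝ} (hl0 : 0 ≤ l)
    (hl1 : l ≤ 1) :
    1 ≤ copyDensity X φ -
      ∑ T ∈ F, l / 4 * (M.edgeFinset.filter fun b => Sym2.map φ b ∈ Γ.boundaryEdges T).card *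
        islandDensity M Γ X T +
      islandDensity M Γ X (Set.range φ) - (1 - l) * islandDensity M Γ X T₀ := by
  have hmem := (meanPairs M Γ X).sub_mem ((meanPairs M Γ X).add_mem ((meanPairs M Γ X).sub_mem
    ((meanPairs M Γ X).sum_mem fun b (_ : b ∈ M.edgeFinset) =>
      edge_mem_meanPairs (Sym2.map φ b))
    ((meanPairs M Γ X).sum_mem fun T (_ : T ∈ F) => (meanPairs M Γ X).smul_mem
      (l / 4 * (M.edgeFinset.filter fun b => Sym2.map φ b ∈ Γ.boundaryEdges T).card)
      (island_mem_meanPairs T)))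
    (island_mem_meanPairs (Set.range φ)))
    ((meanPairs M Γ X).smul_mem (1 - l) (island_mem_meanPairs T₀))
  have := MulAction.le_of_mem_meanPairs (finite_hitsAndIslands h2 hX hfin) hmem
    (C := 1) fun g => by
      simpa [Prod.fst_sum] using
        one_le_weighted_hits h2 (hX.preimage g) φ hbd hF hT₀ hl0 hl1
  simpa [Prod.snd_sum, copyDensity] using this

theorem one_le_copyDensity_add_sub (h2 : HasTwoCrossing M)
    (hX : IsBoundaryRepresentative M Γ X) (hfin : X.Finite) (φ : Copy M Γ)
    (hbd : (Γ.boundaryEdges (Set.range φ)).Nonempty) {T : Set V} (hT : Crosses T φ) :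
    1 ≤ copyDensity X φ + islandDensity M Γ X (Set.range φ) - islandDensity M Γ X T := by
  -- With `l = 0` only the `T₀` term survives.
  have := one_le_weighted_copyDensity h2 hX hfin φ hbd (F := ∅) (by simp) hT le_rfl zero_le_one
  simpa using this

end Density

/-! ### Bad sets, cheap and expensive. -/

section Bad

variable {V : Type u} {U : Type*} [Fintype U] {M : SimpleGraph U} [DecidableRel M.Adj]
  {Γ : SimpleGraph V} {X : Set (Sym2 V)}

variable (M Γ X) in
/-- The smallest density of a copy of `M` with vertex set `S`. -/
noncomputable def minCopyDensity (S : Set V) : ℝ :=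
  sInf {r | ∃ φ : Copy M Γ, Set.range φ = S ∧ copyDensity X φ = r}

theorem finite_copyDensities {S : Set V} (hS : S.Finite) :
    {r | ∃ φ : Copy M Γ, Set.range φ = S ∧ copyDensity X φ = r}.Finite := by
  have h1 : {φ : Copy M Γ | Set.range φ = S}.Finite := by
    refine Set.Finite.of_finite_image (f := fun φ : Copy M Γ => (φ : U → V)) ?_ ?_
    · refine (Set.Finite.pi' (fun _ : U => hS)).subset ?_
      rintro _ ⟨φ, hφ, rfl⟩ x
      rw [← show Set.range φ = S from hφ]
      exact ⟨x, rfl⟩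
    · intro φ _ ψ _ h
      exact DFunLike.coe_injective h
  exact h1.image (copyDensity X)

theorem minCopyDensity_le (φ : Copy M Γ) :
    minCopyDensity M Γ X (Set.range φ) ≤ copyDensity X φ :=
  csInf_le (finite_copyDensities (Set.finite_range φ)).bddBelow ⟨φ, rfl, rfl⟩

theorem exists_copyDensity_eq (φ : Copy M Γ) : ∃ ψ : Copy M Γ, Set.range ψ = Set.range φ ∧
    copyDensity X ψ = minCopyDensity M Γ X (Set.range φ) :=
  Set.Nonempty.csInf_mem
    (s := {r | ∃ ψ : Copy M Γ, Set.range ψ = Set.range φ ∧ copyDensity X ψ = r})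
    ⟨copyDensity X φ, φ, rfl, rfl⟩ (finite_copyDensities (Set.finite_range φ))

theorem minCopyDensity_image (g : Γ ≃g Γ) (S : Set V) :
    minCopyDensity M Γ X (g '' S) = minCopyDensity M Γ X S := by
  unfold minCopyDensity
  congr 1
  ext r
  constructor
  · rintro ⟨φ, hφ, rfl⟩
    refine ⟨g.symm.toCopy.comp φ, ?_, copyDensity_comp _ _⟩
    rw [range_comp_copy, hφ]
    exact g.toEquiv.symm_image_image S
  · rintro ⟨φ, rfl, rfl⟩
    exact ⟨g.toCopy.comp φ, range_comp_copy g φ, copyDensity_comp _ _⟩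

variable (M Γ X) in
/-- The vertex sets, with nonempty boundary, of copies of `M` of density less than one. -/
def badSets : Set (Set V) :=
  {S | (Γ.boundaryEdges S).Nonempty ∧ (∃ φ : Copy M Γ, Set.range φ = S) ∧
    minCopyDensity M Γ X S < 1}

theorem image_mem_badSets {g : Γ ≃g Γ} {S : Set V} (hS : S ∈ badSets M Γ X) :
    g '' S ∈ badSets M Γ X := by
  obtain ⟨h1, ⟨φ, rfl⟩, h3⟩ := hS
  exact ⟨(boundaryEdges_image_nonempty g _).mpr h1, ⟨_, range_comp_copy g φ⟩,
    (minCopyDensity_image g _).trans_lt h3⟩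

theorem one_sub_minCopyDensity_le (h2 : HasTwoCrossing M)
    (hX : IsBoundaryRepresentative M Γ X) (hfin : X.Finite) {S : Set V}
    (hS : S ∈ badSets M Γ X) : 1 - minCopyDensity M Γ X S ≤ islandDensity M Γ X S := by
  obtain ⟨hbd, ⟨φ, rfl⟩, -⟩ := hS
  obtain ⟨ψ, hψ, hψm⟩ := exists_copyDensity_eq (X := X) φ
  rw [← hψ] at hbd hψm ⊢
  have := one_le_copyDensity_add h2 hX hfin ψ hbd
  linarith

theorem islandDensity_pos (h2 : HasTwoCrossing M)
    (hX : IsBoundaryRepresentative M Γ X) (hfin : X.Finite) {S : Set V}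
    (hS : S ∈ badSets M Γ X) : 0 < islandDensity M Γ X S := by
  have h1 := one_sub_minCopyDensity_le h2 hX hfin hS
  have h3 := hS.2.2
  linarith

/-- A bad set is an island more often than any vertex set of a copy of `M` crossing it. -/
theorem one_sub_minCopyDensity_le_sub (h2 : HasTwoCrossing M)
    (hX : IsBoundaryRepresentative M Γ X) (hfin : X.Finite) {S : Set V}
    (hS : S ∈ badSets M Γ X) {T : Set V} (hT : (S ∩ T).Nonempty ∧ (S \ T).Nonempty) :
    1 - minCopyDensity M Γ X S ≤ islandDensity M Γ X S - islandDensity M Γ X T := by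
  obtain ⟨hbd, ⟨φ, rfl⟩, -⟩ := hS
  obtain ⟨ψ, hψ, hψm⟩ := exists_copyDensity_eq (X := X) φ
  rw [← hψ] at hbd hψm hT ⊢
  have := one_le_copyDensity_add_sub h2 hX hfin ψ hbd hT
  linarith

/-- Of two bad sets crossing each other, each would have strictly larger island density than the
other. -/
theorem eq_or_disjoint_of_mem_badSets (h2 : HasTwoCrossing M)
    (hX : IsBoundaryRepresentative M Γ X) (hfin : X.Finite) {S T : Set V}
    (hS : S ∈ badSets M Γ X) (hT : T ∈ badSets M Γ X) : S = T ∨ Disjoint S T := by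
  obtain ⟨φ, hφ⟩ := hS.2.1
  obtain ⟨ψ, hψ⟩ := hT.2.1
  rcases eq_or_disjoint_or_crosses φ ψ with h | h | ⟨h, h'⟩
  · exact Or.inl (hφ ▸ hψ ▸ h)
  · exact Or.inr (hφ ▸ hψ ▸ h)
  · rw [Crosses, hφ, hψ] at h h'
    have h3 := one_sub_minCopyDensity_le_sub h2 hX hfin hS h
    have h4 := one_sub_minCopyDensity_le_sub h2 hX hfin hT h'
    have h5 := hS.2.2
    have h6 := hT.2.2
    linarith

theorem finite_badSets (h2 : HasTwoCrossing M) (hX : IsBoundaryRepresentative M Γ X)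
    (hfin : X.Finite) : (badSets M Γ X).Finite :=
  (finite_islandDensity_ne_zero h2 hX hfin).subset
    fun _ hS => (islandDensity_pos h2 hX hfin hS).ne'

/-- The standing assumptions: `M` has no cuts with fewer than two edges and is large enough or a
triangle, and `X` is a finite set that contains the boundary of every copy of `M` avoiding it. -/
structure BoundaryRepresentation (M : SimpleGraph U) [DecidableRel M.Adj] (Γ : SimpleGraph V)
    (X : Set (Sym2 V)) : Prop where
  two : HasTwoCrossing M
  rep : IsBoundaryRepresentative M Γ X
  fin : X.Finite
  large : 4 ≤ M.edgeFinset.card ∨ (M.edgeFinset.card = 3 ∧ M = ⊤)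

variable (h : BoundaryRepresentation M Γ X)

/-- The edges of positive density. -/
noncomputable def BoundaryRepresentation.support : Finset (Sym2 V) :=
  (finite_hitDensity_ne_zero h.two h.rep h.fin).toFinset

/-- The bad sets as a finite set. -/
noncomputable def BoundaryRepresentation.bad : Finset (Set V) :=
  (finite_badSets h.two h.rep h.fin).toFinset

namespace BoundaryRepresentation

theorem three_le (h : BoundaryRepresentation M Γ X) : 3 ≤ M.edgeFinset.card := by
  rcases h.large with h | h <;> omega

theorem mem_support {a : Sym2 V} : a ∈ h.support ↔ hitDensity M Γ X a ≠ 0 := by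
  simp [support]

theorem mem_bad {S : Set V} : S ∈ h.bad ↔ S ∈ badSets M Γ X := by
  simp [bad]

theorem islandDensity_le (h : BoundaryRepresentation M Γ X) {S : Set V} {a : Sym2 V} (ha : a ∈ Γ.boundaryEdges S) :
    islandDensity M Γ X S ≤ hitDensity M Γ X a :=
  islandDensity_le_hitDensity h.two h.rep h.fin ha

/-- Consequently `boundaryCard` counts the whole boundary of a bad set, and corrections never leave
the support. -/
theorem mem_support_of_mem_boundaryEdges {S : Set V} (hS : S ∈ h.bad) {a : Sym2 V}
    (ha : a ∈ Γ.boundaryEdges S) : a ∈ h.support := by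
  have h1 := h.islandDensity_le ha
  have h3 := islandDensity_pos h.two h.rep h.fin (h.mem_bad.mp hS)
  rw [mem_support]
  linarith

theorem sum_support_map (g : Γ ≃g Γ) (f : Sym2 V → ℝ) :
    ∑ a ∈ h.support, f (Sym2.map g a) = ∑ a ∈ h.support, f a := by
  refine Finset.sum_nbij' (Sym2.map g) (Sym2.map g.symm) ?_ ?_ ?_ ?_ ?_
  · intro a ha
    rwa [mem_support, hitDensity_map, ← mem_support]
  · intro a ha
    rwa [mem_support, hitDensity_map, ← mem_support]
  · intro a _
    simp [Sym2.map_map]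
  · intro a _
    simp [Sym2.map_map]
  · intro a _
    rfl

theorem sum_bad_image (g : Γ ≃g Γ) (f : Set V → ℝ) :
    ∑ S ∈ h.bad, f (g '' S) = ∑ S ∈ h.bad, f S := by
  refine Finset.sum_nbij' (Set.image g) (Set.image g.symm) ?_ ?_ ?_ ?_ ?_
  · intro S hS
    exact h.mem_bad.mpr (image_mem_badSets (h.mem_bad.mp hS))
  · intro S hS
    exact h.mem_bad.mpr (image_mem_badSets (h.mem_bad.mp hS))
  · intro S _
    simp [Set.image_image]
  · intro S _
    simp [Set.image_image]
  · intro S _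
    rfl

open Classical in
/-- The total density of the edges inside `S`. -/
noncomputable def insideWeight (S : Set V) : ℝ :=
  ∑ a ∈ h.support, if a ∈ Γ.insideEdges S then hitDensity M Γ X a else 0

open Classical in
/-- The number of boundary edges of positive density of `S`. -/
noncomputable def boundaryCard (S : Set V) : ℕ :=
  (h.support.filter fun a => a ∈ Γ.boundaryEdges S).card

theorem insideWeight_image (g : Γ ≃g Γ) (S : Set V) :
    h.insideWeight (g '' S) = h.insideWeight S := by
  classical
  unfold insideWeight
  rw [← h.sum_support_map g]
  exact Finset.sum_congr rfl fun a _ =>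
    if_congr (map_mem_insideEdges_iff g S a) (hitDensity_map g a) rfl

open Classical in
theorem cast_boundaryCard (S : Set V) : (h.boundaryCard S : ℝ) =
    ∑ a ∈ h.support, if a ∈ Γ.boundaryEdges S then (1 : ℝ) else 0 := by
  rw [boundaryCard, Finset.card_filter]
  push_cast
  rfl

theorem boundaryCard_image (g : Γ ≃g Γ) (S : Set V) :
    h.boundaryCard (g '' S) = h.boundaryCard S := by
  classical
  have : (h.boundaryCard (g '' S) : ℝ) = h.boundaryCard S := by
    rw [cast_boundaryCard, cast_boundaryCard, ← h.sum_support_map g]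
    exact Finset.sum_congr rfl fun a _ => if_congr (map_mem_boundaryEdges_iff g S a) rfl rfl
  exact_mod_cast this

theorem insideWeight_nonneg (S : Set V) : 0 ≤ h.insideWeight S :=
  Finset.sum_nonneg fun a _ => by
    split_ifs
    · exact hitDensity_nonneg a
    · exact le_rfl

/-- It costs no more to take all boundary edges of the translates of `S` than to hit the copies
inside them. -/
def IsCheap (S : Set V) : Prop :=
  (1 - islandDensity M Γ X S) * h.boundaryCard S ≤ M.edgeFinset.card * h.insideWeight S

theorem isCheap_image (g : Γ ≃g Γ) (S : Set V) : h.IsCheap (g '' S) ↔ h.IsCheap S := by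
  rw [IsCheap, IsCheap, islandDensity_image, boundaryCard_image, insideWeight_image]

/-- The weight that is moved away from each boundary edge of an expensive bad set, relative to the
deficiency of the set. -/
noncomputable def reduction (S : Set V) : ℝ :=
  h.insideWeight S / (minCopyDensity M Γ X S * h.boundaryCard S)

theorem reduction_image (g : Γ ≃g Γ) (S : Set V) : h.reduction (g '' S) = h.reduction S := by
  rw [reduction, reduction, insideWeight_image, minCopyDensity_image, boundaryCard_image]

/-- A copy of a complete graph uses every edge inside its vertex set. -/
theorem insideWeight_eq_of_eq_top (hM : M = ⊤) (φ : Copy M Γ) :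
    h.insideWeight (Set.range φ) = copyDensity X φ := by
  classical
  have hinj : Function.Injective (Sym2.map φ) := Sym2.map.injective φ.injective
  rw [insideWeight, ← Finset.sum_filter, copyDensity,
    ← Finset.sum_image (f := fun a => hitDensity M Γ X a) hinj.injOn]
  refine Finset.sum_subset ?_ ?_
  · intro a ha
    obtain ⟨-, ha⟩ := Finset.mem_filter.mp ha
    induction a with
    | _ p q =>
      obtain ⟨x, rfl⟩ := ha.2 p (by simp)
      obtain ⟨y, rfl⟩ := ha.2 q (by simp)
      refine Finset.mem_image.mpr ⟨s(x, y), ?_, rfl⟩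
      have hne : x ≠ y := fun hxy => ha.1.ne (by rw [hxy])
      subst hM
      simpa using hne
  · intro a ha hna
    obtain ⟨b, hb, rfl⟩ := Finset.mem_image.mp ha
    by_contra hne
    refine hna (Finset.mem_filter.mpr ⟨h.mem_support.mpr hne, ?_, ?_⟩)
    · induction b with
      | _ x y => exact φ.toHom.map_adj (mem_edgeFinset.mp hb)
    · induction b with
      | _ x y => simp

theorem pos_of_not_isCheap {S : Set V} (hS : S ∈ h.bad) (hc : ¬ h.IsCheap S) :
    0 < minCopyDensity M Γ X S ∧ 0 < h.boundaryCard S := by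
  rw [IsCheap, not_le] at hc
  have h1 := h.insideWeight_nonneg S
  have h3 : 0 ≤ (M.edgeFinset.card : ℝ) * h.insideWeight S := by positivity
  have h4 := one_sub_minCopyDensity_le h.two h.rep h.fin (h.mem_bad.mp hS)
  have h5 : (0 : ℝ) ≤ h.boundaryCard S := by positivity
  have h6 : 0 < (1 - islandDensity M Γ X S) * h.boundaryCard S := h3.trans_lt hc
  have h7 := pos_of_mul_pos_left h6 h5
  have h8 : (0 : ℝ) < h.boundaryCard S := pos_of_mul_pos_right h6 h7.le
  exact ⟨by linarith, by exact_mod_cast h8⟩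

theorem reduction_nonneg {S : Set V} (hS : S ∈ h.bad) (hc : ¬ h.IsCheap S) :
    0 ≤ h.reduction S :=
  div_nonneg (h.insideWeight_nonneg S)
    (mul_nonneg (h.pos_of_not_isCheap hS hc).1.le (by positivity))

/-- Not being cheap, together with `1 - q ≤ m`, bounds the reduction by `1 / e`, which suffices for
`e ≥ 4`. For the triangle the inside weight equals `m`, so the reduction is the reciprocal of the
boundary size; that size exceeds 3, and integrality makes it at least 4. -/
theorem reduction_le {S : Set V} (hS : S ∈ h.bad) (hc : ¬ h.IsCheap S) :
    h.reduction S ≤ 1 / 4 := by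
  obtain ⟨hm, hb⟩ := h.pos_of_not_isCheap hS hc
  have hb' : (0 : ℝ) < h.boundaryCard S := by exact_mod_cast hb
  rw [IsCheap, not_le] at hc
  have h1 := h.insideWeight_nonneg S
  have h4 := one_sub_minCopyDensity_le h.two h.rep h.fin (h.mem_bad.mp hS)
  have h5 : (1 - islandDensity M Γ X S) * h.boundaryCard S ≤
      minCopyDensity M Γ X S * h.boundaryCard S :=
    mul_le_mul_of_nonneg_right (by linarith) hb'.le
  rw [reduction, div_le_iff₀ (mul_pos hm hb')]
  rcases h.large with h4e | ⟨h3e, hM⟩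
  · have h6 : (4 : ℝ) ≤ M.edgeFinset.card := by exact_mod_cast h4e
    have h7 := mul_le_mul_of_nonneg_right h6 h1
    linarith
  · have hw : h.insideWeight S = minCopyDensity M Γ X S := by
      obtain ⟨φ, rfl⟩ := (h.mem_bad.mp hS).2.1
      obtain ⟨ψ, hψ, hψm⟩ := exists_copyDensity_eq (X := X) φ
      rw [← hψm, ← hψ, h.insideWeight_eq_of_eq_top hM ψ]
    rw [h3e, hw] at hc
    rw [hw]
    push_cast at hc
    have h6 : (3 : ℝ) < h.boundaryCard S := by
      refine lt_of_mul_lt_mul_left ?_ hm.le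
      linarith
    have h7 : (4 : ℝ) ≤ h.boundaryCard S := by
      exact_mod_cast (show 3 < h.boundaryCard S by exact_mod_cast h6)
    nlinarith

end BoundaryRepresentation

end Bad

/-! ### Corrected weights and the invariant set of heavy edges. -/

section Weight

variable {V : Type u} {U : Type*} [Fintype U] {M : SimpleGraph U} [DecidableRel M.Adj]
  {Γ : SimpleGraph V} {X : Set (Sym2 V)} (h : BoundaryRepresentation M Γ X)

namespace BoundaryRepresentation

open Classical in
/-- The correction to the weight of the edge `a` coming from the bad set `S`: weight is moved from
the inside to the boundary if `S` is cheap, and from the boundary to the inside otherwise. -/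
noncomputable def correction (S : Set V) (a : Sym2 V) : ℝ :=
  if h.IsCheap S then
    (if a ∈ Γ.boundaryEdges S then 1 - islandDensity M Γ X S else 0) -
      M.edgeFinset.card * (if a ∈ Γ.insideEdges S then hitDensity M Γ X a else 0)
  else
    M.edgeFinset.card * (1 - minCopyDensity M Γ X S) *
      ((if a ∈ Γ.insideEdges S then hitDensity M Γ X a else 0) / minCopyDensity M Γ X S -
        (if a ∈ Γ.boundaryEdges S then h.reduction S else 0))

/-- The corrected weight of an edge. -/
noncomputable def weight (a : Sym2 V) : ℝ :=
  M.edgeFinset.card * hitDensity M Γ X a + ∑ S ∈ h.bad, h.correction S a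

theorem correction_image_map (g : Γ ≃g Γ) (S : Set V) (a : Sym2 V) :
    h.correction (g '' S) (Sym2.map g a) = h.correction S a := by
  classical
  simp only [correction, isCheap_image, map_mem_boundaryEdges_iff, map_mem_insideEdges_iff,
    islandDensity_image, hitDensity_map, minCopyDensity_image, reduction_image]

theorem weight_map (g : Γ ≃g Γ) (a : Sym2 V) : h.weight (Sym2.map g a) = h.weight a := by
  rw [weight, weight, hitDensity_map, ← h.sum_bad_image g]
  simp only [correction_image_map]

theorem correction_of_notMem {S : Set V} {a : Sym2 V} (h1 : a ∉ Γ.insideEdges S)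
    (h2 : a ∉ Γ.boundaryEdges S) : h.correction S a = 0 := by
  simp [correction, h1, h2]

theorem eq_or_disjoint {S T : Set V} (hS : S ∈ h.bad) (hT : T ∈ h.bad) : S = T ∨ Disjoint S T :=
  eq_or_disjoint_of_mem_badSets h.two h.rep h.fin (h.mem_bad.mp hS) (h.mem_bad.mp hT)

/-- For cheap sets this is the definition of cheapness; for the others `reduction` is chosen so that
the sum is exactly zero. -/
theorem sum_correction_le {S : Set V} (hS : S ∈ h.bad) :
    ∑ a ∈ h.support, h.correction S a ≤ 0 := by
  classical
  by_cases hc : h.IsCheap S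
  · have h1 : ∀ a ∈ h.support, h.correction S a =
        (1 - islandDensity M Γ X S) * (if a ∈ Γ.boundaryEdges S then 1 else 0) -
        M.edgeFinset.card * (if a ∈ Γ.insideEdges S then hitDensity M Γ X a else 0) := by
      intro a _
      rw [correction, if_pos hc]
      congr 1
      split_ifs <;> simp
    rw [Finset.sum_congr rfl h1, Finset.sum_sub_distrib, ← Finset.mul_sum, ← Finset.mul_sum,
      ← h.cast_boundaryCard, sub_nonpos]
    exact hc
  · have h1 : ∀ a ∈ h.support, h.correction S a =
        M.edgeFinset.card * (1 - minCopyDensity M Γ X S) *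
        ((if a ∈ Γ.insideEdges S then hitDensity M Γ X a else 0) / minCopyDensity M Γ X S -
          h.reduction S * (if a ∈ Γ.boundaryEdges S then 1 else 0)) := by
      intro a _
      rw [correction, if_neg hc, mul_ite, mul_one, mul_zero]
    obtain ⟨hm, hb⟩ := h.pos_of_not_isCheap hS hc
    have hb' : (h.boundaryCard S : ℝ) ≠ 0 := by exact_mod_cast hb.ne'
    rw [Finset.sum_congr rfl h1, ← Finset.mul_sum, Finset.sum_sub_distrib, ← Finset.sum_div,
      ← Finset.mul_sum, ← h.cast_boundaryCard, ← insideWeight, reduction]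
    refine le_of_eq ?_
    field_simp
    ring

theorem weight_of_notMem_support {a : Sym2 V} (ha : a ∉ h.support) : h.weight a = 0 := by
  have h0 : hitDensity M Γ X a = 0 := by
    by_contra hne
    exact ha (h.mem_support.mpr hne)
  rw [weight, h0, mul_zero, zero_add]
  refine Finset.sum_eq_zero fun S hS => ?_
  have hb : a ∉ Γ.boundaryEdges S := fun hb => ha (h.mem_support_of_mem_boundaryEdges hS hb)
  simp [correction, hb, h0]

theorem sum_weight_le : ∑ a ∈ h.support, h.weight a ≤ M.edgeFinset.card * X.ncard := by
  simp only [weight]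
  rw [Finset.sum_add_distrib, ← Finset.mul_sum, Finset.sum_comm]
  have h1 := Finset.sum_nonpos fun S hS => h.sum_correction_le hS
  have h2 := mul_le_mul_of_nonneg_left (sum_hitDensity_le (M := M) (Γ := Γ) h.fin h.support)
    (Nat.cast_nonneg (α := ℝ) M.edgeFinset.card)
  linarith

open Classical in
theorem sum_islandDensity_le (a : Sym2 V) {F : Finset (Set V)} (hF : F ⊆ h.bad) :
    ∑ S ∈ F, (if a ∈ Γ.boundaryEdges S then islandDensity M Γ X S else 0) ≤
      2 * hitDensity M Γ X a := by
  rw [← Finset.sum_filter]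
  have hmem : ∀ S ∈ F.filter fun S => a ∈ Γ.boundaryEdges S, S ∈ h.bad ∧ a ∈ Γ.boundaryEdges S :=
    fun S hS => ⟨hF (Finset.mem_filter.mp hS).1, (Finset.mem_filter.mp hS).2⟩
  refine (Finset.sum_le_card_nsmul _ _ _ fun S hS => h.islandDensity_le (hmem S hS).2).trans ?_
  rw [nsmul_eq_mul]
  refine mul_le_mul_of_nonneg_right ?_ (hitDensity_nonneg a)
  exact_mod_cast card_le_two_of_mem_boundaryEdges
    (fun S hS T hT hne => (h.eq_or_disjoint (hmem S hS).1 (hmem T hT).1).resolve_left hne)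
    fun S hS => (hmem S hS).2

-- Away from the inside of cheap sets, weight is lost only on boundaries of expensive sets, at rate
-- `e * (1 - m)` times a reduction of at most 1/4, and `1 - m ≤ q`.
open Classical in
theorem le_correction {S : Set V} (hS : S ∈ h.bad) {a : Sym2 V}
    (ha : h.IsCheap S → a ∉ Γ.insideEdges S) :
    -(M.edgeFinset.card / 4 * (if a ∈ Γ.boundaryEdges S then islandDensity M Γ X S else 0)) ≤
      h.correction S a := by
  have hδ := hitDensity_nonneg (M := M) (Γ := Γ) (X := X) a
  have he : (0 : ℝ) ≤ M.edgeFinset.card := by positivity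
  by_cases hc : h.IsCheap S
  · have h1 := islandDensity_le_one h.two h.rep h.fin S
    have h3 := islandDensity_nonneg (M := M) (Γ := Γ) (X := X) S
    rw [correction, if_pos hc, if_neg (ha hc)]
    split_ifs
    · have : 0 ≤ M.edgeFinset.card / 4 * islandDensity M Γ X S := by positivity
      linarith
    · simp
  · have hm := (h.pos_of_not_isCheap hS hc).1
    have hm1 := (h.mem_bad.mp hS).2.2
    have hq := one_sub_minCopyDensity_le h.two h.rep h.fin (h.mem_bad.mp hS)
    have hr0 := h.reduction_nonneg hS hc
    have hr := h.reduction_le hS hc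
    rw [correction, if_neg hc, mul_sub]
    have h1 : 0 ≤ M.edgeFinset.card * (1 - minCopyDensity M Γ X S) *
        ((if a ∈ Γ.insideEdges S then hitDensity M Γ X a else 0) / minCopyDensity M Γ X S) := by
      refine mul_nonneg (mul_nonneg he (by linarith)) (div_nonneg ?_ hm.le)
      split_ifs
      · exact hδ
      · exact le_rfl
    by_cases hb : a ∈ Γ.boundaryEdges S
    · rw [if_pos hb, if_pos hb]
      have h2 : (1 - minCopyDensity M Γ X S) * h.reduction S ≤
          islandDensity M Γ X S * (1 / 4) := by
        gcongr
        exact islandDensity_nonneg S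
      have h3 := mul_le_mul_of_nonneg_left h2 he
      linarith
    · rwa [if_neg hb, if_neg hb, mul_zero, neg_zero, mul_zero, sub_zero]

/-- Inside a cheap set the weight is exactly 0. Elsewhere at most two bad sets have `a` on their
boundary, each costing at most `eδ / 4`, so half of `eδ` survives. -/
theorem weight_nonneg (a : Sym2 V) : 0 ≤ h.weight a := by
  classical
  by_cases hex : ∃ S ∈ h.bad, h.IsCheap S ∧ a ∈ Γ.insideEdges S
  · obtain ⟨S, hS, hc, ha⟩ := hex
    rw [weight, Finset.sum_eq_single_of_mem S hS]
    · rw [correction, if_pos hc, if_pos ha,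
        if_neg (disjoint_insideEdges_boundaryEdges (Or.inl rfl) ha)]
      linarith
    · intro T hT hne
      have hd := (h.eq_or_disjoint hS hT).resolve_left hne.symm
      exact h.correction_of_notMem (notMem_insideEdges_of_disjoint hd ha)
        (disjoint_insideEdges_boundaryEdges (Or.inr hd) ha)
  · push Not at hex
    have h1 := Finset.sum_le_sum fun S hS => h.le_correction hS (a := a) (hex S hS)
    rw [Finset.sum_neg_distrib, ← Finset.mul_sum] at h1
    have h2 := h.sum_islandDensity_le a subset_rfl
    have hδ := hitDensity_nonneg (M := M) (Γ := Γ) (X := X) a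
    have he : (0 : ℝ) ≤ M.edgeFinset.card := by positivity
    have h3 := mul_le_mul_of_nonneg_left h2 (by positivity : 0 ≤ (M.edgeFinset.card : ℝ) / 4)
    rw [weight]
    nlinarith [mul_nonneg he hδ]

/-- The set `S` adds `1 - q(S)`, while at least `eδ / 2` of the initial weight survives the other
bad sets; this covers `q(S) ≤ δ` since `e ≥ 3`. -/
theorem one_le_weight_of_mem_boundaryEdges {S : Set V} (hS : S ∈ h.bad) (hc : h.IsCheap S)
    {a : Sym2 V} (ha : a ∈ Γ.boundaryEdges S) : 1 ≤ h.weight a := by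
  classical
  have hin : ∀ T ∈ h.bad, a ∉ Γ.insideEdges T := fun T hT hin =>
    disjoint_insideEdges_boundaryEdges (h.eq_or_disjoint hT hS) hin ha
  have h1 := Finset.sum_le_sum fun T (hT : T ∈ h.bad.erase S) =>
    h.le_correction (Finset.mem_of_mem_erase hT) (a := a) fun _ =>
      hin T (Finset.mem_of_mem_erase hT)
  rw [Finset.sum_neg_distrib, ← Finset.mul_sum] at h1
  have h2 := h.sum_islandDensity_le a (Finset.erase_subset S h.bad)
  have hδ := hitDensity_nonneg (M := M) (Γ := Γ) (X := X) a
  have he : (3 : ℝ) ≤ M.edgeFinset.card := by exact_mod_cast h.three_le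
  have h3 := mul_le_mul_of_nonneg_left h2 (by positivity : 0 ≤ (M.edgeFinset.card : ℝ) / 4)
  have h4 := h.islandDensity_le ha
  have h5 : h.correction S a = 1 - islandDensity M Γ X S := by
    rw [correction, if_pos hc, if_pos ha, if_neg (hin S hS)]
    simp
  rw [weight, ← Finset.add_sum_erase _ _ hS, h5]
  nlinarith [mul_le_mul_of_nonneg_right he hδ]

open Classical in
/-- The number of edges of a copy of `M` that lie on the boundary of `T`. -/
noncomputable def crossingCard (φ : Copy M Γ) (T : Set V) : ℕ :=
  (M.edgeFinset.filter fun b => Sym2.map φ b ∈ Γ.boundaryEdges T).card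

open Classical in
theorem le_sum_correction {S : Set V} (hS : S ∈ h.bad) (hc : ¬ h.IsCheap S) (φ : Copy M Γ) :
    -(M.edgeFinset.card * ((1 - minCopyDensity M Γ X S) / 4 * crossingCard φ S)) ≤
      ∑ b ∈ M.edgeFinset, h.correction S (Sym2.map φ b) := by
  have he : (0 : ℝ) ≤ M.edgeFinset.card := by positivity
  have hm := (h.pos_of_not_isCheap hS hc).1
  have hm1 := (h.mem_bad.mp hS).2.2
  have hr := h.reduction_le hS hc
  rw [crossingCard, Finset.card_filter]
  push_cast
  rw [Finset.mul_sum, Finset.mul_sum, ← Finset.sum_neg_distrib]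
  refine Finset.sum_le_sum fun b hb => ?_
  rw [correction, if_neg hc, mul_assoc, ← mul_neg]
  refine mul_le_mul_of_nonneg_left ?_ he
  have h1 : 0 ≤ (if Sym2.map φ b ∈ Γ.insideEdges S then hitDensity M Γ X (Sym2.map φ b) else 0) /
      minCopyDensity M Γ X S := by
    refine div_nonneg ?_ hm.le
    split_ifs
    · exact hitDensity_nonneg _
    · exact le_rfl
  have h2 : (if Sym2.map φ b ∈ Γ.boundaryEdges S then h.reduction S else 0) ≤
      1 / 4 * (if Sym2.map φ b ∈ Γ.boundaryEdges S then 1 else 0) := by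
    split_ifs
    · linarith
    · simp
  have h3 := mul_le_mul_of_nonneg_left (sub_le_sub h1 h2)
    (by linarith : 0 ≤ 1 - minCopyDensity M Γ X S)
  refine le_trans (le_of_eq ?_) h3
  ring

theorem sum_correction_eq_of_range_eq (φ : Copy M Γ)
    (hc : ¬ h.IsCheap (Set.range φ)) :
    ∑ b ∈ M.edgeFinset, h.correction (Set.range φ) (Sym2.map φ b) =
      M.edgeFinset.card * (1 - minCopyDensity M Γ X (Set.range φ)) *
        (copyDensity X φ / minCopyDensity M Γ X (Set.range φ)) := by
  rw [copyDensity, Finset.sum_div, Finset.mul_sum]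
  refine Finset.sum_congr rfl fun b hb => ?_
  have hin := map_mem_insideEdges φ (mem_edgeFinset.mp hb)
  rw [correction, if_neg hc, if_pos hin,
    if_neg (disjoint_insideEdges_boundaryEdges (Or.inl rfl) hin), sub_zero]

theorem sum_weight_map (φ : Copy M Γ) : ∑ b ∈ M.edgeFinset, h.weight (Sym2.map φ b) =
    M.edgeFinset.card * copyDensity X φ +
      ∑ S ∈ h.bad, ∑ b ∈ M.edgeFinset, h.correction S (Sym2.map φ b) := by
  simp only [weight]
  rw [Finset.sum_add_distrib, ← Finset.mul_sum, Finset.sum_comm, copyDensity]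

theorem sum_correction_of_disjoint (φ : Copy M Γ) {S : Set V} (hd : Disjoint (Set.range φ) S) :
    ∑ b ∈ M.edgeFinset, h.correction S (Sym2.map φ b) = 0 := by
  refine Finset.sum_eq_zero fun b hb => ?_
  have hin := map_mem_insideEdges φ (mem_edgeFinset.mp hb)
  exact h.correction_of_notMem (notMem_insideEdges_of_disjoint hd hin)
    (disjoint_insideEdges_boundaryEdges (Or.inr hd) hin)

/-- The correction rescales inside weights by `1 / m`, so the copy weighs `e` times its density over
the minimum `m`. Other bad sets are disjoint from it and contribute nothing. -/
theorem card_le_sum_weight_of_mem_bad (φ : Copy M Γ) (hS : Set.range φ ∈ h.bad)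
    (hc : ¬ h.IsCheap (Set.range φ)) :
    (M.edgeFinset.card : ℝ) ≤ ∑ b ∈ M.edgeFinset, h.weight (Sym2.map φ b) := by
  have hm := (h.pos_of_not_isCheap hS hc).1
  have hle := minCopyDensity_le (X := X) φ
  rw [sum_weight_map, Finset.sum_eq_single_of_mem _ hS,
    h.sum_correction_eq_of_range_eq φ hc]
  · have h1 : 1 ≤ copyDensity X φ / minCopyDensity M Γ X (Set.range φ) := by
      rwa [one_le_div hm]
    have h2 : (M.edgeFinset.card : ℝ) * copyDensity X φ +
        M.edgeFinset.card * (1 - minCopyDensity M Γ X (Set.range φ)) *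
        (copyDensity X φ / minCopyDensity M Γ X (Set.range φ)) =
        M.edgeFinset.card * (copyDensity X φ / minCopyDensity M Γ X (Set.range φ)) := by
      field_simp
      ring
    rw [h2]
    exact le_mul_of_one_le_right (by positivity) h1
  · intro T hT hne
    exact h.sum_correction_of_disjoint φ ((h.eq_or_disjoint hS hT).resolve_left hne.symm)

/-- The copy has density at least 1, and only expensive bad sets crossing it can take weight away.
The averaged inequality, with `l` tuned to these sets, pays for all the losses at once. -/
theorem card_le_sum_weight_of_notMem_bad (φ : Copy M Γ)
    (hbd : (Γ.boundaryEdges (Set.range φ)).Nonempty) (hS : Set.range φ ∉ h.bad)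
    (hc : ∀ T ∈ h.bad, h.IsCheap T → Disjoint (Set.range φ) T) :
    (M.edgeFinset.card : ℝ) ≤ ∑ b ∈ M.edgeFinset, h.weight (Sym2.map φ b) := by
  classical
  have he : (0 : ℝ) ≤ M.edgeFinset.card := by positivity
  have hone : 1 ≤ copyDensity X φ := by
    by_contra! hlt
    exact hS (h.mem_bad.mpr ⟨hbd, ⟨φ, rfl⟩, (minCopyDensity_le φ).trans_lt hlt⟩)
  set F := h.bad.filter fun T => Crosses T φ with hFdef
  have hcross : ∀ T ∈ h.bad, ¬ Disjoint (Set.range φ) T → Crosses T φ ∧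
      (T ∩ Set.range φ).Nonempty ∧ (T \ Set.range φ).Nonempty := by
    intro T hT hnd
    obtain ⟨ψ, hψ⟩ := (h.mem_bad.mp hT).2.1
    rcases eq_or_disjoint_or_crosses φ ψ with h1 | h1 | ⟨h1, h2⟩
    · exact absurd (h1.trans hψ ▸ hT) hS
    · exact absurd (hψ ▸ h1) hnd
    · rw [hψ] at h1
      rw [Crosses, hψ] at h2
      exact ⟨h1, h2⟩
  have hFsum : ∑ T ∈ h.bad, ∑ b ∈ M.edgeFinset, h.correction T (Sym2.map φ b) =
      ∑ T ∈ F, ∑ b ∈ M.edgeFinset, h.correction T (Sym2.map φ b) := by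
    refine (Finset.sum_subset (Finset.filter_subset _ _) fun T hT hTF => ?_).symm
    refine h.sum_correction_of_disjoint φ (by_contra fun hnd => hTF ?_)
    exact Finset.mem_filter.mpr ⟨hT, (hcross T hT hnd).1⟩
  rw [sum_weight_map, hFsum]
  rcases F.eq_empty_or_nonempty with hF | hF
  · rw [hF, Finset.sum_empty, add_zero]
    exact le_mul_of_one_le_right he hone
  obtain ⟨T₀, hT₀, hmax⟩ := F.exists_max_image (islandDensity M Γ X) hF
  have hnd : ∀ T ∈ F, T ∈ h.bad ∧ ¬ Disjoint (Set.range φ) T := fun T hT =>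
    ⟨(Finset.mem_filter.mp hT).1,
      Set.not_disjoint_iff_nonempty_inter.mpr (Finset.mem_filter.mp hT).2.1⟩
  have hdef : ∀ T ∈ F, 1 - minCopyDensity M Γ X T ≤
      islandDensity M Γ X T - islandDensity M Γ X (Set.range φ) := fun T hT =>
    one_sub_minCopyDensity_le_sub h.two h.rep h.fin (h.mem_bad.mp (hnd T hT).1)
      (hcross T (hnd T hT).1 (hnd T hT).2).2
  set q := islandDensity M Γ X (Set.range φ) with hq
  set q₀ := islandDensity M Γ X T₀ with hq₀
  have hqpos : 0 ≤ q := islandDensity_nonneg _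
  have hq₀pos : 0 < q₀ :=
    islandDensity_pos h.two h.rep h.fin (h.mem_bad.mp (hnd T₀ hT₀).1)
  have hqq : q ≤ q₀ := by
    have h1 := hdef T₀ hT₀
    have h2 := (h.mem_bad.mp (hnd T₀ hT₀).1).2.2
    linarith
  have hl1 : 1 - (1 - q / q₀) = q / q₀ := by ring
  have hl0 : 0 ≤ 1 - q / q₀ := sub_nonneg.mpr ((div_le_one hq₀pos).mpr hqq)
  -- The choice `l = 1 - q / q₀` cancels the term `q` against `(1 - l) * q₀`. Since `q₀` is the
  -- maximum over `F`, it also gives `1 - m(T) ≤ q(T) - q ≤ l * q(T)` for all `T ∈ F`.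
  have hmain := one_le_weighted_copyDensity h.two h.rep h.fin φ hbd (F := F)
    (fun T hT => (Finset.mem_filter.mp hT).2) (Finset.mem_filter.mp hT₀).2 hl0
    (sub_le_self _ (by positivity))
  rw [← hq, ← hq₀, hl1, div_mul_cancel₀ _ hq₀pos.ne', add_sub_cancel_right] at hmain
  have hterm : ∀ T ∈ F, -(M.edgeFinset.card * ((1 - q / q₀) / 4 *
      crossingCard φ T * islandDensity M Γ X T)) ≤
      ∑ b ∈ M.edgeFinset, h.correction T (Sym2.map φ b) := by
    intro T hT
    have hTc : ¬ h.IsCheap T := fun hTc => (hnd T hT).2 (hc T (hnd T hT).1 hTc)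
    refine le_trans ?_ (h.le_sum_correction (hnd T hT).1 hTc φ)
    rw [neg_le_neg_iff]
    refine mul_le_mul_of_nonneg_left ?_ he
    have h1 : 1 - minCopyDensity M Γ X T ≤ (1 - q / q₀) * islandDensity M Γ X T := by
      refine (hdef T hT).trans ?_
      have h2 : q / q₀ * islandDensity M Γ X T ≤ q := by
        calc q / q₀ * islandDensity M Γ X T ≤ q / q₀ * q₀ :=
              mul_le_mul_of_nonneg_left (hmax T hT) (by positivity)
          _ = q := div_mul_cancel₀ _ hq₀pos.ne'
      linarith
    have h3 := mul_le_mul_of_nonneg_right h1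
      (by positivity : (0 : ℝ) ≤ crossingCard φ T / 4)
    linarith
  have hsum := Finset.sum_le_sum hterm
  rw [Finset.sum_neg_distrib, ← Finset.mul_sum] at hsum
  have hmain' := mul_le_mul_of_nonneg_left hmain he
  simp only [crossingCard] at hsum
  rw [mul_one, mul_sub] at hmain'
  linarith

/-- The edges of corrected weight at least one. -/
def heavyEdges : Set (Sym2 V) := {a | a ∈ Γ.edgeSet ∧ 1 ≤ h.weight a}

theorem image_heavyEdges (g : Γ ≃g Γ) : Sym2.map g '' h.heavyEdges = h.heavyEdges := by
  have hmap : ∀ (g : Γ ≃g Γ), ∀ a ∈ h.heavyEdges, Sym2.map g a ∈ h.heavyEdges := fun g a ha =>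
    ⟨(map_mem_edgeSet_iff g a).mpr ha.1, (h.weight_map g a).symm ▸ ha.2⟩
  refine Set.Subset.antisymm (Set.image_subset_iff.mpr (hmap g)) fun a ha => ?_
  exact ⟨Sym2.map g.symm a, hmap g.symm a ha, by simp [Sym2.map_map]⟩

theorem encard_heavyEdges_le : h.heavyEdges.encard ≤ (M.edgeFinset.card : ℕ∞) * X.encard := by
  classical
  set Y := h.support.filter fun a => a ∈ h.heavyEdges with hY
  have hsub : h.heavyEdges = Y := by
    ext a
    simp only [hY, Finset.coe_filter, Set.mem_ofPred_eq]
    refine ⟨fun ha => ⟨by_contra fun hna => ?_, ha⟩, fun ha => ha.2⟩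
    have := ha.2
    rw [h.weight_of_notMem_support hna] at this
    linarith
  have hcard : (Y.card : ℝ) ≤ M.edgeFinset.card * X.ncard := by
    calc (Y.card : ℝ) = ∑ a ∈ Y, 1 := by simp
      _ ≤ ∑ a ∈ Y, h.weight a := Finset.sum_le_sum fun a ha => (Finset.mem_filter.mp ha).2.2
      _ ≤ ∑ a ∈ h.support, h.weight a :=
          Finset.sum_le_sum_of_subset_of_nonneg (Finset.filter_subset _ _)
            fun a _ _ => h.weight_nonneg a
      _ ≤ _ := h.sum_weight_le
  rw [hsub, Set.encard_coe_eq_coe_finsetCard, ← h.fin.cast_ncard_eq]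
  exact_mod_cast hcard

/-- A copy disjoint from all cheap bad sets has `e` edges of total weight at least `e`, so one of
them is heavy. A cheap bad set meeting the copy has only heavy boundary edges: if it equals the
vertex set, `f` is one of them, and if it crosses the copy, some edge of the copy is. -/
theorem exists_heavyEdge (φ : Copy M Γ) {f : Sym2 V} (hf : f ∈ Γ.boundaryEdges (Set.range φ)) :
    f ∈ h.heavyEdges ∨ ∃ b ∈ M.edgeSet, Sym2.map φ b ∈ h.heavyEdges := by
  have hedge : ∀ b ∈ M.edgeSet, Sym2.map φ b ∈ Γ.edgeSet := fun b hb =>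
    (map_mem_insideEdges φ hb).1
  by_cases hc : ∀ T ∈ h.bad, h.IsCheap T → Disjoint (Set.range φ) T
  · right
    have hsum : (M.edgeFinset.card : ℝ) ≤ ∑ b ∈ M.edgeFinset, h.weight (Sym2.map φ b) := by
      by_cases hS : Set.range φ ∈ h.bad
      · refine h.card_le_sum_weight_of_mem_bad φ hS fun hch => ?_
        have h1 := hc _ hS hch
        rw [disjoint_self, Set.bot_eq_empty] at h1
        obtain ⟨u, v, -, hu, -, -⟩ := hf
        rw [h1] at hu
        exact hu
      · exact h.card_le_sum_weight_of_notMem_bad φ ⟨f, hf⟩ hS hc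
    by_contra! hcon
    have hlt : ∑ b ∈ M.edgeFinset, h.weight (Sym2.map φ b) < ∑ b ∈ M.edgeFinset, (1 : ℝ) := by
      refine Finset.sum_lt_sum_of_nonempty ?_ fun b hb => ?_
      · exact Finset.card_pos.mp (by have := h.three_le; omega)
      · by_contra! hle
        have hb' := mem_edgeFinset.mp hb
        exact hcon b hb' ⟨hedge b hb', hle⟩
    rw [Finset.sum_const, nsmul_eq_mul, mul_one] at hlt
    linarith
  · push Not at hc
    obtain ⟨T, hT, hTc, hnd⟩ := hc
    have hheavy : ∀ a ∈ Γ.boundaryEdges T, a ∈ h.heavyEdges := fun a ha =>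
      ⟨boundaryEdges_subset T ha, h.one_le_weight_of_mem_boundaryEdges hT hTc ha⟩
    obtain ⟨ψ, rfl⟩ := (h.mem_bad.mp hT).2.1
    rcases eq_or_disjoint_or_crosses φ ψ with h1 | h1 | ⟨h1, -⟩
    · exact Or.inl (hheavy f (h1 ▸ hf))
    · exact absurd h1 hnd
    · obtain ⟨b, hb, -, -, -, hbT, -⟩ := h1.exists_two_edges h.two
      exact Or.inr ⟨b, hb, hheavy _ hbT⟩

end BoundaryRepresentation

end Weight

/-! ### From `K` to `K` without its pendant vertex, and back. -/

section Pendant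

variable {W : Type v} {K : SimpleGraph W} {t r : W}

/-- A neighbour `w ≠ t` of `r` is not adjacent to `t`, so it keeps its degree of at least 2 when `t`
is deleted; transitivity carries this to every vertex. -/
theorem exists_two_adj_induce [Fintype W] [DecidableRel K.Adj] (hconn : K.Connected)
    (huniq : ∀ w : W, K.degree w = 1 → w = t) (hr : K.Adj t r) (hr' : ∀ w, K.Adj t w → w = r)
    (htrans : (K.induce {w : W | w ≠ t}).IsVertexTransitive) (x : {w : W | w ≠ t}) :
    ∃ y z, (K.induce {w : W | w ≠ t}).Adj x y ∧ (K.induce {w : W | w ≠ t}).Adj x z ∧ y ≠ z := by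
  classical
  have : Nontrivial W := ⟨t, r, hr.ne⟩
  have hdeg : ∀ w, w ≠ t → ∃ y z, K.Adj w y ∧ K.Adj w z ∧ y ≠ z := by
    intro w hw
    have h1 : K.degree w ≠ 1 := fun h => hw (huniq w h)
    have h2 := hconn.preconnected.degree_pos_of_nontrivial w
    obtain ⟨y, hy, z, hz, hne⟩ := Finset.one_lt_card.mp
      (show 1 < (K.neighborFinset w).card by rw [card_neighborFinset_eq_degree]; omega)
    exact ⟨y, z, by simpa using hy, by simpa using hz, hne⟩
  obtain ⟨w, hw, hwt⟩ : ∃ w, K.Adj r w ∧ w ≠ t := by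
    obtain ⟨y, z, hy, hz, hne⟩ := hdeg r hr.ne'
    by_cases hyt : y = t
    · exact ⟨z, hz, fun hzt => hne (hyt.trans hzt.symm)⟩
    · exact ⟨y, hy, hyt⟩
  obtain ⟨y, z, hy, hz, hne⟩ := hdeg w hwt
  have hnt : ∀ y, K.Adj w y → y ≠ t := by
    rintro y hy rfl
    exact hw.ne (hr' w hy.symm).symm
  obtain ⟨ψ, hψ⟩ := htrans ⟨w, hwt⟩ x
  refine ⟨ψ ⟨y, hnt y hy⟩, ψ ⟨z, hnt z hz⟩, ?_, ?_, ?_⟩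
  · rw [← hψ]
    exact ψ.map_adj_iff.mpr hy
  · rw [← hψ]
    exact ψ.map_adj_iff.mpr hz
  · intro h
    exact hne (congrArg Subtype.val (ψ.injective h))

/-- Minimum degree 2 gives at least as many edges as vertices; on at most three vertices only the
triangle is possible. -/
theorem edgeFinset_card_of_two_adj {U : Type*} [Fintype U] [Nonempty U] {M : SimpleGraph U}
    [DecidableRel M.Adj] (hM : ∀ x, ∃ y z, M.Adj x y ∧ M.Adj x z ∧ y ≠ z) :
    4 ≤ M.edgeFinset.card ∨ (M.edgeFinset.card = 3 ∧ M = ⊤) := by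
  classical
  have hdeg : ∀ x, 2 ≤ M.degree x := by
    intro x
    obtain ⟨y, z, hy, hz, hne⟩ := hM x
    rw [← card_neighborFinset_eq_degree]
    exact Finset.one_lt_card.mpr ⟨y, by simpa using hy, z, by simpa using hz, hne⟩
  have hsum := M.sum_degrees_eq_twice_card_edges
  have hsum2 : Fintype.card U * 2 ≤ ∑ x, M.degree x := by
    have := Finset.card_nsmul_le_sum Finset.univ (fun x => M.degree x) 2 fun x _ => hdeg x
    simpa using this
  obtain ⟨x⟩ := ‹Nonempty U›
  have hlt := M.degree_lt_card_verts x
  have h2 := hdeg x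
  rcases Nat.lt_or_ge 3 (Fintype.card U) with h4 | h3
  · left
    omega
  · right
    have hcard : Fintype.card U = 3 := by omega
    have htop : M = ⊤ := by
      ext a b
      simp only [top_adj]
      refine ⟨fun h => h.ne, fun hne => ?_⟩
      obtain ⟨y, z, hy, hz, hyz⟩ := hM a
      by_contra hab
      have hby : b ≠ y := fun h => hab (h ▸ hy)
      have hbz : b ≠ z := fun h => hab (h ▸ hz)
      have hle := Finset.card_le_univ ({a, b, y, z} : Finset U)
      rw [Finset.card_insert_of_notMem, Finset.card_insert_of_notMem,
        Finset.card_insert_of_notMem, Finset.card_singleton] at hle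
      · omega
      · simpa using hyz
      · simp [hby, hbz]
      · simp [hne, hy.ne, hz.ne]
    refine ⟨?_, htop⟩
    subst htop
    have := card_edgeFinset_top_eq_card_choose_two (V := U)
    rw [hcard, show Nat.choose 3 2 = 3 from rfl] at this
    convert this

theorem card_edgeFinset_induce_lt [Fintype W] [DecidableRel K.Adj] (hr : K.Adj t r)
    [Fintype {w : W | w ≠ t}] [DecidableRel (K.induce {w : W | w ≠ t}).Adj] :
    (K.induce {w : W | w ≠ t}).edgeFinset.card < K.edgeSet.ncard := by
  classical
  rw [← coe_edgeFinset, Set.ncard_coe_finset]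
  have hinj : Function.Injective (Sym2.map (Subtype.val : {w : W | w ≠ t} → W)) :=
    Sym2.map.injective Subtype.val_injective
  rw [← Finset.card_image_of_injective _ hinj]
  refine Finset.card_lt_card ⟨?_, fun hsub => ?_⟩
  · intro a ha
    obtain ⟨b, hb, rfl⟩ := Finset.mem_image.mp ha
    induction b with
    | _ x y => simpa using hb
  · obtain ⟨b, -, hb⟩ := Finset.mem_image.mp (hsub (mem_edgeFinset.mpr hr : s(t, r) ∈ _))
    have : t ∈ Sym2.map (Subtype.val : {w : W | w ≠ t} → W) b := by rw [hb]; simp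
    obtain ⟨x, -, hx⟩ := Sym2.mem_map.mp this
    exact x.2 hx

/-- A copy of `K` minus the pendant vertex `t`, extended by an edge at the image of the neighbour
of `t`. -/
theorem exists_copy_extending (hr : K.Adj t r) (hr' : ∀ w, K.Adj t w → w = r) {V : Type u}
    {Γ : SimpleGraph V} (φ : Copy (K.induce {w : W | w ≠ t}) Γ) {z : V}
    (hz : Γ.Adj (φ ⟨r, hr.ne'⟩) z) (hzφ : z ∉ Set.range φ) :
    ∃ χ : Copy K Γ, χ t = z ∧ ∀ w : {w : W | w ≠ t}, χ w = φ w := by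
  classical
  let f : W → V := fun w => if hw : w ≠ t then φ ⟨w, hw⟩ else z
  have hft : f t = z := by simp [f]
  have hf : ∀ w (hw : w ≠ t), f w = φ ⟨w, hw⟩ := fun w hw => by simp [f, hw]
  refine ⟨⟨⟨f, ?_⟩, ?_⟩, hft, fun w => hf w w.2⟩
  · intro a b hab
    by_cases ha : a = t
    · subst ha
      obtain rfl := hr' b hab
      rw [hft, hf b hr.ne']
      exact hz.symm
    by_cases hb : b = t
    · subst hb
      obtain rfl := hr' a hab.symm
      rw [hft, hf a hr.ne']
      exact hz
    rw [hf a ha, hf b hb]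
    exact φ.toHom.map_adj hab
  · intro a b hab
    change f a = f b at hab
    by_cases ha : a = t <;> by_cases hb : b = t
    · rw [ha, hb]
    · rw [ha, hft, hf b hb] at hab
      exact absurd ⟨_, hab.symm⟩ hzφ
    · rw [hb, hft, hf a ha] at hab
      exact absurd ⟨_, hab⟩ hzφ
    · rw [hf a ha, hf b hb] at hab
      exact congrArg Subtype.val (φ.injective hab)

/-- Precompose the copy with an automorphism taking `r` to the inner end of the boundary edge, and
extend it by that edge to a copy of `K`. The extension meets `X`, and can do so only in the new
edge. -/
theorem IsEdgeRepresentative.isBoundaryRepresentative (hr : K.Adj t r)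
    (hr' : ∀ w, K.Adj t w → w = r) (htrans : (K.induce {w : W | w ≠ t}).IsVertexTransitive)
    {V : Type u} {Γ : SimpleGraph V} {X : Set (Sym2 V)} (hX : IsEdgeRepresentative K Γ X) :
    IsBoundaryRepresentative (K.induce {w : W | w ≠ t}) Γ X := by
  rintro φ hφ _ ⟨_, z, hadj, ⟨x, rfl⟩, hz, rfl⟩
  obtain ⟨ψ, hψ⟩ := htrans ⟨r, hr.ne'⟩ x
  obtain ⟨χ, hχt, hχ⟩ := exists_copy_extending hr hr' (φ.comp ψ.toCopy) (z := z)
    (by rw [← hψ] at hadj; exact hadj) (fun ⟨y, hy⟩ => hz ⟨ψ y, hy⟩)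
  obtain ⟨e, he, heX⟩ := hX.2 χ.toSubgraph ⟨χ.isoToSubgraph⟩
  rw [Subgraph.edgeSet_map, Subgraph.edgeSet_top] at he
  obtain ⟨b, hb, rfl⟩ := he
  induction b with
  | _ a b =>
    have hrx : χ r = φ x := by
      rw [hχ ⟨r, hr.ne'⟩, ← hψ]
      rfl
    by_cases ha : a = t
    · subst ha
      obtain rfl := hr' b hb
      have : Sym2.map χ.toHom s(a, b) = s(φ x, z) := by
        rw [Sym2.map_mk, Sym2.eq_swap]
        exact congrArg₂ (fun p q => s(p, q)) hrx hχt
      rwa [this] at heX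
    by_cases hbt : b = t
    · subst hbt
      obtain rfl := hr' a hb.symm
      have : Sym2.map χ.toHom s(a, b) = s(φ x, z) := by
        rw [Sym2.map_mk]
        exact congrArg₂ (fun p q => s(p, q)) hrx hχt
      rwa [this] at heX
    · refine absurd ?_ (hφ s(ψ ⟨a, ha⟩, ψ ⟨b, hbt⟩) (ψ.map_adj_iff.mpr hb))
      have : Sym2.map χ.toHom s(a, b) = Sym2.map φ s(ψ ⟨a, ha⟩, ψ ⟨b, hbt⟩) := by
        rw [Sym2.map_mk, Sym2.map_mk]
        exact congrArg₂ (fun p q => s(p, q)) (hχ ⟨a, ha⟩) (hχ ⟨b, hbt⟩)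
      rwa [this] at heX

theorem isEdgeRepresentative_of_boundary (hr : K.Adj t r) {V : Type u} {Γ : SimpleGraph V}
    {Y : Set (Sym2 V)} (hsub : Y ⊆ Γ.edgeSet)
    (hY : ∀ φ : Copy (K.induce {w : W | w ≠ t}) Γ, ∀ f ∈ Γ.boundaryEdges (Set.range φ),
      f ∈ Y ∨ ∃ b ∈ (K.induce {w : W | w ≠ t}).edgeSet, Sym2.map φ b ∈ Y) :
    IsEdgeRepresentative K Γ Y := by
  refine ⟨hsub, fun H ⟨ι⟩ => ?_⟩
  let χ : Copy K Γ := H.coeCopy.comp ι.toCopy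
  have hH : ∀ a b, K.Adj a b → s(χ a, χ b) ∈ H.edgeSet := fun a b hab => ι.map_adj_iff.mpr hab
  have hf : s(χ r, χ t) ∈
      Γ.boundaryEdges (Set.range (χ.comp (Copy.induce K {w : W | w ≠ t}))) := by
    refine ⟨χ r, χ t, χ.toHom.map_adj hr.symm, ⟨⟨r, hr.ne'⟩, rfl⟩, ?_, rfl⟩
    rintro ⟨w, hw⟩
    exact w.2 (χ.injective hw)
  rcases hY _ _ hf with h | ⟨b, hb, h⟩
  · exact ⟨_, hH r t hr.symm, h⟩
  · induction b with
    | _ x y => exact ⟨_, hH x y hb, h⟩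

theorem symEdgeRep_le [Fintype W] [DecidableRel K.Adj] (hconn : K.Connected)
    (ht : K.degree t = 1) (huniq : ∀ w : W, K.degree w = 1 → w = t)
    (htrans : (K.induce {w : W | w ≠ t}).IsVertexTransitive) {V : Type u} (Γ : SimpleGraph V) :
    symEdgeRep K Γ ≤ ((K.edgeSet.ncard - 1 : ℕ) : ℕ∞) * edgeRep K Γ := by
  classical
  obtain ⟨r, hr, hr'⟩ := degree_eq_one_iff_existsUnique_adj.mp ht
  have htwo := exists_two_adj_induce hconn huniq hr hr' htrans
  have hMconn : (K.induce {w : W | w ≠ t}).Connected :=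
    hconn.induce_compl_singleton_of_degree_eq_one ht
  have := hMconn.nonempty
  have hlarge := edgeFinset_card_of_two_adj htwo
  have hlt := card_edgeFinset_induce_lt hr
  have hne : {n : ℕ∞ | ∃ X : Set (Sym2 V), IsEdgeRepresentative K Γ X ∧ X.encard = n}.Nonempty := by
    refine ⟨_, Γ.edgeSet, ⟨subset_rfl, fun H ⟨ι⟩ => ?_⟩, rfl⟩
    exact ⟨s((ι t : V), (ι r : V)), ι.map_adj_iff.mpr hr, H.edgeSet_subset (ι.map_adj_iff.mpr hr)⟩
  obtain ⟨X, hX, hXcard⟩ := csInf_mem hne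
  change X.encard = edgeRep K Γ at hXcard
  rw [← hXcard]
  by_cases hfin : X.Finite
  · have h : BoundaryRepresentation (K.induce {w : W | w ≠ t}) Γ X :=
      { two := fun A hA hA' => exists_two_crossing_edges hMconn htrans (fun x y _ => by
          obtain ⟨p, q, hp, hq, hpq⟩ := htwo x
          by_cases hpy : p = y
          · exact ⟨q, hq, fun hqy => hpq (hpy.trans hqy.symm)⟩
          · exact ⟨p, hp, hpy⟩) hA hA'
        rep := hX.isBoundaryRepresentative hr hr' htrans
        fin := hfin
        large := hlarge }
    calc symEdgeRep K Γ ≤ h.heavyEdges.encard :=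
          sInf_le ⟨h.heavyEdges, isEdgeRepresentative_of_boundary hr (fun a ha => ha.1)
            fun φ f hf => h.exists_heavyEdge φ hf, h.image_heavyEdges, rfl⟩
      _ ≤ _ := h.encard_heavyEdges_le
      _ ≤ _ := by
        gcongr
        omega
  -- In `ℕ∞` the product `0 * ⊤` is `0`, so the bound is infinite only because `K` has more than one
  -- edge.
  · rw [Set.encard_eq_top_iff.mpr hfin, ENat.mul_top]
    · exact le_top
    · have : K.edgeSet.ncard - 1 ≠ 0 := by omega
      exact_mod_cast this

end Pendant

end SimpleGraph

theorem mainTheorem1 {W : Type v} [Fintype W] (K : SimpleGraph W) [DecidableRel K.Adj]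
    (hconn : K.Connected)
    (t : W) (ht : K.degree t = 1) (huniq : ∀ w : W, K.degree w = 1 → w = t)
    (htrans : (K.induce {w : W | w ≠ t}).IsVertexTransitive) :
    (∀ (V : Type u) (Γ : SimpleGraph V),
      SimpleGraph.symEdgeRep K Γ ≤
        ((K.edgeSet.ncard - 1 : ℕ) : ℕ∞) * SimpleGraph.edgeRep K Γ) ∧
    ¬ SimpleGraph.IsEdgeCostly.{u} K := by
  refine ⟨fun V Γ => SimpleGraph.symEdgeRep_le hconn ht huniq htrans Γ, fun hcostly => ?_⟩
  -- Taking `m = 1` excludes `n = 0`, where both values vanish and there is no contradiction.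
  obtain ⟨V, Γ, n, s, hn, hs, hsn, hm⟩ := hcostly 1
  have hle := SimpleGraph.symEdgeRep_le hconn ht huniq htrans Γ
  rw [hn, hs] at hle
  have hle' : s ≤ (K.edgeSet.ncard - 1) * n := by exact_mod_cast hle
  have hspos : 0 < s := by exact_mod_cast hm
  have hnpos : 0 < n := Nat.pos_of_mul_pos_right (hsn ▸ hspos)
  have hKpos : 0 < K.edgeSet.ncard := Nat.pos_of_mul_pos_left (hsn ▸ hspos)
  rw [hsn, mul_comm] at hle'
  have := Nat.le_of_mul_le_mul_right hle' hnpos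
  omega
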